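/- Let $\Xi_g=\bigl\{\sum_{k=1}^\infty x_k2^{-k}: x_k\in\{0,1\},\ x_kx_{2k}=0 \text{ for all } k\ge 1\bigr\}\subset[0,1]$ be the multiplicative golden mean set, and let $F_1=1$, $F_2=2$, $F_{k+1}=F_{k-1}+F_k$ for $k\ge 2$. There is exactly one $p\in(0,1)$ with $p^3=(1-p)^2$, and the Hausdorff dimension of $\Xi_g$ is $$\dim_H(\Xi_g)=-\log_2 p=0.81137\ldots$$ The Minkowski (box-counting) dimension $\dim_M(\Xi_g)=\lim_{\varepsilon\to0+}\frac{\log N(\varepsilon)}{\log(1/\varepsilon)}$, where $N(\varepsilon)$ is the least number of closed balls of radius $\varepsilon$ that cover $\Xi_g$, exists, and $$\dim_M(\Xi_g)=\sum_{k=1}^\infty\frac{\log_2F_{k+1}}{2^{k+1}}=0.82429\ldots$$ In particular $\dim_H(\Xi_g)<\dim_M(\Xi_g)$. -/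

import Mathlib

open Filter Topology
open scoped NNReal ENNReal

/-- The multiplicative golden mean set `Ξ_g ⊆ ℝ`: all sums `∑_{k ≥ 1} x_k 2^{-k}` with digits
`x_k ∈ {0, 1}` such that `x_k x_{2k} = 0` for all `k ≥ 1` (the value `x 0` plays no role). -/
def multGoldenMeanSet : Set ℝ :=
  {t | ∃ x : ℕ → ℕ, (∀ k, 1 ≤ k → x k = 0 ∨ x k = 1) ∧ (∀ k, 1 ≤ k → x k * x (2 * k) = 0) ∧
    HasSum (fun n : ℕ => (x (n + 1) : ℝ) / 2 ^ (n + 1)) t}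

/-- The Fibonacci numbers with the indexing `F 1 = 1`, `F 2 = 2`, `F (k + 1) = F (k - 1) + F k`. -/
def shiftedFib (k : ℕ) : ℕ := Nat.fib (k + 1)

/-- The nonempty, totally bounded set `s` has a Minkowski (box-counting) dimension, equal to `d`:
the limit as `ε → 0+` of `log N(ε) / log (1 / ε)` exists and equals `d`, where `N(ε)` is the
least number of closed balls of radius `ε` that cover `s`. -/
def HasMinkowskiDim {X : Type*} [PseudoMetricSpace X] (s : Set X) (d : ℝ) : Prop :=
  s.Nonempty ∧ TotallyBounded s ∧
    Tendsto (fun ε : ℝ≥0 =>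
        Real.log ((Metric.externalCoveringNumber ε s).toNat : ℝ) / Real.log (1 / (ε : ℝ)))
      (𝓝[>] 0) (𝓝 d)

/-! The constraint links only positions in the same chain `j, 2j, 4j, …` with `j` odd, and on each
chain it forbids two consecutive ones. A chain of length `L` therefore has `Nat.fib (L + 2)`
fillings, and the number of words of length `n` is a product over odd `j` (`card_goldenWords`).
About `n / 2 ^ (k + 2)` chains have length `k + 1`, which gives the growth rate
(`tendsto_logb_card_goldenWords`). Covering numbers at scale `2 ^ (-n)` agree with word counts up to
a bounded shift of `n`, hence the Minkowski dimension.

For the Hausdorff dimension, run on every chain the Markov chain that puts 0 after 1 and otherwise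
chooses 1 with probability `1 - p` and 0 with probability `p`. Since `1 - p = p ^ (3 / 2)`, a word
`A` has weight `p` to the power `n + |A| / 2 - |A ∩ [1, n / 2]|` (`wordWeight_golden`). Upper bound:
along `n = 2 ^ k` the correction to `n` is governed by the increment of the density of ones. A
bounded sequence has small increments arbitrarily late, so every point has prefixes of weight at
least about `p ^ n`, and such words are few. Lower bound: for a typical random sequence the density
of ones converges (Chernoff bound, Borel–Cantelli, contraction under halving), so all long prefixes
have weight at most about `p ^ n`. The mass distribution principle concludes. -/

/-- The binary words of length `n` satisfying the multiplicative golden mean constraint,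
encoded by the set of positions of the digit `1`. -/
def goldenWords (n : ℕ) : Finset (Finset ℕ) :=
  (Finset.Icc 1 n).powerset.filter fun A => ∀ k ∈ A, 2 * k ∉ A

/-- The weight of the `m`-th digit of the word `A` for a Markov chain running along the
sequences `i, 2i, 4i, …`: after a digit `1` the digit `0` has weight `γ` and the digit `1` is
forbidden, otherwise the digits `1` and `0` have weights `α m` and `β m`. -/
noncomputable def stepWeight (α β : ℕ → ℝ) (γ : ℝ) (A : Finset ℕ) (m : ℕ) : ℝ :=
  if 2 ∣ m ∧ m / 2 ∈ A then (if m ∈ A then 0 else γ) else (if m ∈ A then α m else β m)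

/-- The weight of a word of length `n`. -/
noncomputable def wordWeight (α β : ℕ → ℝ) (γ : ℝ) (n : ℕ) (A : Finset ℕ) : ℝ :=
  ∏ m ∈ Finset.Icc 1 n, stepWeight α β γ A m

theorem stepWeight_insert_succ (α β : ℕ → ℝ) (γ : ℝ) (A : Finset ℕ) {n m : ℕ} (hm : m ≤ n) :
    stepWeight α β γ (insert (n + 1) A) m = stepWeight α β γ A m := by
  have h1 : m ≠ n + 1 := by omega
  have h2 : m / 2 ≠ n + 1 := by omega
  simp [stepWeight, Finset.mem_insert, h1, h2]

theorem wordWeight_succ (α β : ℕ → ℝ) (γ : ℝ) (n : ℕ) (A : Finset ℕ) :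
    wordWeight α β γ (n + 1) A = wordWeight α β γ n A * stepWeight α β γ A (n + 1) := by
  rw [wordWeight, Finset.prod_Icc_succ_top (by omega), wordWeight]

theorem wordWeight_insert_succ (α β : ℕ → ℝ) (γ : ℝ) (n : ℕ) (A : Finset ℕ) :
    wordWeight α β γ n (insert (n + 1) A) = wordWeight α β γ n A :=
  Finset.prod_congr rfl fun _ hm =>
    stepWeight_insert_succ α β γ A (Finset.mem_Icc.1 hm).2

/-- The last digit looks back only at half its position and no earlier factor sees it, so it can be
summed out. Summing over all subsets is harmless because inadmissible ones have weight 0. -/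
theorem sum_wordWeight_succ (α β : ℕ → ℝ) (γ : ℝ) (n : ℕ) :
    ∑ A ∈ (Finset.Icc 1 (n + 1)).powerset, wordWeight α β γ (n + 1) A =
      ∑ A ∈ (Finset.Icc 1 n).powerset, wordWeight α β γ n A *
        (if 2 ∣ n + 1 ∧ (n + 1) / 2 ∈ A then γ else α (n + 1) + β (n + 1)) := by
  have hnot : n + 1 ∉ Finset.Icc 1 n := by simp
  rw [← Finset.insert_Icc_right_eq_Icc_add_one (by omega), Finset.sum_powerset_insert hnot,
    ← Finset.sum_add_distrib]
  refine Finset.sum_congr rfl fun A hA => ?_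
  have hA' : n + 1 ∉ A := fun h => hnot (Finset.mem_powerset.1 hA h)
  have h2 : (n + 1) / 2 ≠ n + 1 := by omega
  rw [wordWeight_succ, wordWeight_succ, wordWeight_insert_succ, ← mul_add]
  congr 1
  simp only [stepWeight, Finset.mem_insert, h2, hA', false_or, true_or, if_true, if_false]
  split_ifs <;> ring

theorem sum_wordWeight_eq_one {α β : ℕ → ℝ} {n : ℕ} (h : ∀ m ∈ Finset.Icc 1 n, α m + β m = 1) :
    ∑ A ∈ (Finset.Icc 1 n).powerset, wordWeight α β 1 n A = 1 := by
  induction n with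
  | zero => simp [wordWeight]
  | succ n ih =>
    rw [sum_wordWeight_succ]
    refine Eq.trans ?_ (ih fun m hm => h m (Finset.Icc_subset_Icc_right (by omega) hm))
    refine Finset.sum_congr rfl fun A _ => ?_
    rw [h (n + 1) (by simp), ite_self, mul_one]

theorem stepWeight_nonneg {α β : ℕ → ℝ} {γ : ℝ} (hα : ∀ m, 0 ≤ α m) (hβ : ∀ m, 0 ≤ β m)
    (hγ : 0 ≤ γ) (A : Finset ℕ) (m : ℕ) : 0 ≤ stepWeight α β γ A m := by
  unfold stepWeight
  split_ifs <;> simp [hα, hβ, hγ]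

theorem wordWeight_nonneg {α β : ℕ → ℝ} {γ : ℝ} (hα : ∀ m, 0 ≤ α m) (hβ : ∀ m, 0 ≤ β m)
    (hγ : 0 ≤ γ) (n : ℕ) (A : Finset ℕ) : 0 ≤ wordWeight α β γ n A :=
  Finset.prod_nonneg fun _ _ => stepWeight_nonneg hα hβ hγ _ _

theorem sum_wordWeight_le_pow {α β : ℕ → ℝ} {γ K : ℝ} (hα : ∀ m, 0 ≤ α m) (hβ : ∀ m, 0 ≤ β m)
    (hγ : 0 ≤ γ) (hK : ∀ m, α m + β m ≤ K) (hγK : γ ≤ K) (n : ℕ) :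
    ∑ A ∈ (Finset.Icc 1 n).powerset, wordWeight α β γ n A ≤ K ^ n := by
  induction n with
  | zero => simp [wordWeight]
  | succ n ih =>
    rw [sum_wordWeight_succ, pow_succ]
    refine le_trans ?_ (mul_le_mul_of_nonneg_right ih (hγ.trans hγK))
    rw [Finset.sum_mul]
    refine Finset.sum_le_sum fun A _ => mul_le_mul_of_nonneg_left ?_
      (wordWeight_nonneg hα hβ hγ n A)
    split_ifs
    exacts [hγK, hK _]

theorem wordWeight_eq_zero_of_notMem {α β : ℕ → ℝ} {γ : ℝ} {n : ℕ} {A : Finset ℕ}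
    (hA : A ∈ (Finset.Icc 1 n).powerset) (h : A ∉ goldenWords n) : wordWeight α β γ n A = 0 := by
  simp only [goldenWords, Finset.mem_filter, hA, true_and, not_forall, not_not] at h
  obtain ⟨k, hk, h2k⟩ := h
  refine Finset.prod_eq_zero (Finset.mem_powerset.1 hA h2k) ?_
  simp [stepWeight, hk, h2k]

theorem sum_goldenWords_wordWeight (α β : ℕ → ℝ) (γ : ℝ) (n : ℕ) :
    ∑ A ∈ goldenWords n, wordWeight α β γ n A =
      ∑ A ∈ (Finset.Icc 1 n).powerset, wordWeight α β γ n A :=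
  Finset.sum_subset (Finset.filter_subset _ _) fun _ hA h => wordWeight_eq_zero_of_notMem hA h

/-! ### Counting words -/

/-- The number of admissible fillings of the positions `j, 2j, 4j, … ≤ n`. -/
def chainCount (n j : ℕ) : ℕ := Nat.fib (Nat.size (n / j) + 2)

theorem chainCount_pos (n j : ℕ) : 0 < chainCount n j := Nat.fib_pos.2 (by omega)

theorem chainCount_of_lt {n j : ℕ} (h : n < j) : chainCount n j = 1 := by
  simp [chainCount, Nat.div_eq_of_lt h]

theorem Nat.size_div_two_add_one {a : ℕ} (ha : 0 < a) : Nat.size (a / 2) + 1 = Nat.size a := by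
  conv_rhs => rw [← Nat.bit_bodd_div2 a]
  rw [Nat.size_bit (by rw [Nat.bit_bodd_div2]; omega), Nat.div2_val]

/-- Condition on the digit at `j`: a 0 leaves the chain from `2j` free, a 1 forces 0 at `2j` and
leaves the chain from `4j` free. `Nat.size (n / j)` is the length of the chain from `j`. -/
theorem chainCount_add {n j : ℕ} (hj : 0 < j) (h : j ≤ n) :
    chainCount n j = chainCount n (2 * j) + chainCount n (4 * j) := by
  have h1 : 0 < n / j := Nat.div_pos h hj
  have e2 : n / (2 * j) = n / j / 2 := by rw [mul_comm, Nat.div_div_eq_div_mul]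
  have e4 : n / (4 * j) = n / j / 2 / 2 := by
    rw [Nat.div_div_eq_div_mul, Nat.div_div_eq_div_mul]; congr 1; ring
  have hs := Nat.size_div_two_add_one h1
  rw [chainCount, chainCount, chainCount, e2, e4, ← hs]
  rcases Nat.eq_zero_or_pos (n / j / 2) with h0 | h0
  · simp [h0]; decide
  · rw [← Nat.size_div_two_add_one h0, Nat.fib_add_two (n := Nat.size (n / j / 2 / 2) + 1 + 1)]
    ring

/-- The number of admissible fillings of `j, 2j, 4j, … ≤ n`, given the digits at the other
positions of the word `A`. -/
def freeCount (n : ℕ) (A : Finset ℕ) (j : ℕ) : ℕ :=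
  if 2 ∣ j ∧ j / 2 ∈ A then chainCount n (2 * j) else chainCount n j

theorem freeCount_pos (n : ℕ) (A : Finset ℕ) (j : ℕ) : 0 < freeCount n A j := by
  unfold freeCount; split_ifs <;> exact chainCount_pos _ _

/-- These weights are the transition probabilities of the uniform measure on fillings. Writing every
case as one quotient of `freeCount` makes the product telescope along chains. -/
theorem stepWeight_chainCount {n m : ℕ} {A : Finset ℕ} (hA : A ∈ goldenWords n) :
    stepWeight (fun m => (chainCount n (4 * m) : ℝ) / chainCount n m)
      (fun m => (chainCount n (2 * m) : ℝ) / chainCount n m) 1 A m =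
      (freeCount n A (2 * m) : ℝ) / freeCount n A m := by
  have hA' := (Finset.mem_filter.1 hA).2
  have hp := freeCount_pos n A m
  have hp' : (freeCount n A m : ℝ) ≠ 0 := by positivity
  by_cases hb : 2 ∣ m ∧ m / 2 ∈ A
  · have hm : m ∉ A := by
      have := hA' _ hb.2
      rwa [Nat.mul_div_cancel' hb.1] at this
    have h3 : freeCount n A (2 * m) = freeCount n A m := by
      simp [freeCount, hb, hm]
    rw [h3, div_self hp']
    simp [stepWeight, hb, hm]
  · by_cases hm : m ∈ A
    · simp only [stepWeight, hb, hm, if_false, freeCount]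
      simp [hm, ← mul_assoc]
    · simp only [stepWeight, hb, hm, if_false, freeCount]
      simp [hm]

theorem prod_Icc_freeCount_two_mul {n : ℕ} (A : Finset ℕ) :
    ∏ m ∈ Finset.Icc 1 n, freeCount n A (2 * m) =
      ∏ j ∈ (Finset.Icc 1 n).filter (2 ∣ ·), freeCount n A j := by
  rw [← Finset.prod_image (f := freeCount n A) (g := fun m => 2 * m) (by intro a _ b _ h; simpa using h)]
  symm
  refine Finset.prod_subset ?_ ?_
  · intro j hj
    simp only [Finset.mem_filter, Finset.mem_Icc, Finset.mem_image] at hj ⊢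
    exact ⟨j / 2, by omega, by omega⟩
  · intro j hj hj'
    simp only [Finset.mem_filter, Finset.mem_Icc, Finset.mem_image] at hj hj'
    -- Factors beyond `n` belong to empty chains and equal 1, so only even positions up to `n`
    -- survive.
    have : n < j := by obtain ⟨a, ha, rfl⟩ := hj; by_contra h; exact hj' ⟨by omega, by omega⟩
    unfold freeCount
    split_ifs <;> exact chainCount_of_lt (by omega)

theorem wordWeight_chainCount {n : ℕ} {A : Finset ℕ} (hA : A ∈ goldenWords n) :
    wordWeight (fun m => (chainCount n (4 * m) : ℝ) / chainCount n m)
      (fun m => (chainCount n (2 * m) : ℝ) / chainCount n m) 1 n A *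
      ∏ j ∈ (Finset.Icc 1 n).filter (¬ 2 ∣ ·), (chainCount n j : ℝ) = 1 := by
  have hne : ∀ s : Finset ℕ, (∏ j ∈ s, (freeCount n A j : ℝ)) ≠ 0 := fun s =>
    Finset.prod_ne_zero_iff.2 fun j _ => by have := freeCount_pos n A j; positivity
  have h1 : ∏ j ∈ (Finset.Icc 1 n).filter (¬ 2 ∣ ·), (chainCount n j : ℝ) =
      ∏ j ∈ (Finset.Icc 1 n).filter (¬ 2 ∣ ·), (freeCount n A j : ℝ) := by
    refine Finset.prod_congr rfl fun j hj => ?_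
    simp [freeCount, (Finset.mem_filter.1 hj).2]
  have h2 := congrArg (Nat.cast (R := ℝ)) (prod_Icc_freeCount_two_mul (n := n) A)
  push_cast at h2
  rw [wordWeight, Finset.prod_congr rfl fun m _ => stepWeight_chainCount hA, Finset.prod_div_distrib,
    h2, h1, div_mul_eq_mul_div, Finset.prod_filter_mul_prod_filter_not, div_self (hne _)]

/-- The total weight is 1 and all admissible words have equal weight, the inverse of the product, so
the product is their number. -/
theorem card_goldenWords (n : ℕ) :
    (goldenWords n).card = ∏ j ∈ (Finset.Icc 1 n).filter (¬ 2 ∣ ·), chainCount n j := by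
  have h := sum_goldenWords_wordWeight (fun m => (chainCount n (4 * m) : ℝ) / chainCount n m)
      (fun m => (chainCount n (2 * m) : ℝ) / chainCount n m) 1 n
  rw [sum_wordWeight_eq_one] at h
  · have h2 : ∀ A ∈ goldenWords n, wordWeight (fun m => (chainCount n (4 * m) : ℝ) / chainCount n m)
      (fun m => (chainCount n (2 * m) : ℝ) / chainCount n m) 1 n A =
        (∏ j ∈ (Finset.Icc 1 n).filter (¬ 2 ∣ ·), (chainCount n j : ℝ))⁻¹ := fun A hA =>
      eq_inv_of_mul_eq_one_left (wordWeight_chainCount hA)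
    rw [Finset.sum_congr rfl h2, Finset.sum_const, nsmul_eq_mul] at h
    have h3 := eq_of_mul_inv_eq_one h
    exact_mod_cast h3
  · intro m hm
    have hm := Finset.mem_Icc.1 hm
    have hp := chainCount_pos n m
    have := chainCount_add hm.1 hm.2
    rw [← add_div, div_eq_one_iff_eq (by positivity)]
    rw [this]; push_cast; ring

/-! ### The golden Markov weight -/

theorem card_filter_two_dvd_and_half_mem (n : ℕ) (A : Finset ℕ) :
    ((Finset.Icc 1 n).filter fun m => 2 ∣ m ∧ m / 2 ∈ A).card =
      (A ∩ Finset.Icc 1 (n / 2)).card := by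
  refine Finset.card_nbij' (fun m => m / 2) (fun m => 2 * m) ?_ ?_ ?_ ?_
  · intro m hm
    simp only [Finset.coe_filter, Finset.mem_Icc, Set.mem_ofPred_eq, Finset.coe_inter,
      Set.mem_inter_iff, Finset.mem_coe] at hm ⊢
    exact ⟨hm.2.2, by omega, by omega⟩
  · intro m hm
    simp only [Finset.coe_filter, Finset.mem_Icc, Set.mem_ofPred_eq, Finset.coe_inter,
      Set.mem_inter_iff, Finset.mem_coe] at hm ⊢
    refine ⟨by omega, by omega, ?_⟩
    rw [Nat.mul_div_cancel_left _ (by omega)]; exact hm.1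
  · intro m hm
    simp only [Finset.coe_filter, Set.mem_ofPred_eq] at hm
    exact Nat.mul_div_cancel' hm.2.1
  · intro m _
    exact Nat.mul_div_cancel_left _ (by omega)

theorem wordWeight_golden {p : ℝ} (hp0 : 0 < p) (hp1 : p < 1) (hp : p ^ 3 = (1 - p) ^ 2) {n : ℕ}
    {A : Finset ℕ} (hA : A ∈ goldenWords n) :
    wordWeight (fun _ => 1 - p) (fun _ => p) 1 n A =
      p ^ ((n : ℝ) + (A.card : ℝ) / 2 - ((A ∩ Finset.Icc 1 (n / 2)).card : ℝ)) := by
  have hA' := (Finset.mem_filter.1 hA).2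
  have hsub := Finset.mem_powerset.1 (Finset.mem_filter.1 hA).1
  -- With this, a free 0 contributes exponent 1, a free 1 contributes 3/2 and a forced 0 contributes
  -- 0.
  have hq : 1 - p = p ^ (3 / 2 : ℝ) := by
    have h1 : (p ^ (3 / 2 : ℝ)) ^ 2 = (1 - p) ^ 2 := by
      rw [← hp, ← Real.rpow_natCast, ← Real.rpow_mul hp0.le, ← Real.rpow_natCast]
      norm_num
    exact ((sq_eq_sq₀ (by positivity) (by linarith)).1 h1).symm
  have hstep : ∀ m ∈ Finset.Icc 1 n, stepWeight (fun _ => 1 - p) (fun _ => p) 1 A m =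
      p ^ ((1 : ℝ) + (if m ∈ A then 1 else 0) / 2 - (if 2 ∣ m ∧ m / 2 ∈ A then 1 else 0)) := by
    intro m _
    unfold stepWeight
    by_cases hb : 2 ∣ m ∧ m / 2 ∈ A
    · have hm : m ∉ A := by
        have := hA' _ hb.2
        rwa [Nat.mul_div_cancel' hb.1] at this
      simp [hb, hm]
    · by_cases hm : m ∈ A
      · simp only [hb, hm, if_true, if_false]
        rw [hq]; norm_num
      · simp [hb, hm]
  rw [wordWeight, Finset.prod_congr rfl hstep, ← Real.rpow_sum_of_pos hp0]
  congr 1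
  rw [Finset.sum_sub_distrib, Finset.sum_add_distrib, ← Finset.sum_div]
  congr 1
  · congr 1
    · simp
    · rw [Finset.sum_boole, Finset.filter_mem_eq_inter, Finset.inter_eq_right.2 hsub]
  · rw [Finset.sum_boole, card_filter_two_dvd_and_half_mem]

/-! ### Chain lengths and the growth rate of the number of words -/

/-- The binary logarithm of the number of admissible fillings of a chain of length `k`. -/
noncomputable def chainEntropy (k : ℕ) : ℝ := Real.logb 2 (Nat.fib (k + 2))

theorem Nat.fib_add_two_le_two_pow (k : ℕ) : Nat.fib (k + 2) ≤ 2 ^ k := by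
  induction k with
  | zero => simp
  | succ k ih =>
    have h : Nat.fib (k + 1 + 2) = Nat.fib (k + 1) + Nat.fib (k + 2) := Nat.fib_add_two
    have h' : Nat.fib (k + 1) ≤ Nat.fib (k + 2) := Nat.fib_mono (by omega)
    rw [pow_succ]; omega

theorem one_le_fib_add_two (k : ℕ) : (1 : ℝ) ≤ Nat.fib (k + 2) := by
  exact_mod_cast Nat.fib_pos.2 (by omega)

theorem chainEntropy_nonneg (k : ℕ) : 0 ≤ chainEntropy k :=
  Real.logb_nonneg (by norm_num) (one_le_fib_add_two k)

theorem chainEntropy_le (k : ℕ) : chainEntropy k ≤ k := by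
  have h1 := one_le_fib_add_two k
  rw [chainEntropy, Real.logb_le_iff_le_rpow (by norm_num) (by linarith), Real.rpow_natCast]
  exact_mod_cast Nat.fib_add_two_le_two_pow k

theorem summable_succ_mul_pow_half : Summable fun k : ℕ => ((k : ℝ) + 1) * (1 / 2) ^ k := by
  have h1 := summable_pow_mul_geometric_of_norm_lt_one 1 (r := (1 / 2 : ℝ)) (by norm_num)
  have h2 := summable_geometric_of_lt_one (r := (1 / 2 : ℝ)) (by norm_num) (by norm_num)
  simpa [add_mul] using h1.add h2

theorem chainEntropy_succ_mul_le {k : ℕ} {c : ℝ} (hc : c ≤ (1 / 2) ^ k) :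
    chainEntropy (k + 1) * c ≤ ((k : ℝ) + 1) * (1 / 2) ^ k := by
  have h := chainEntropy_le (k + 1)
  push_cast at h
  have := chainEntropy_nonneg (k + 1)
  calc _ ≤ chainEntropy (k + 1) * (1 / 2) ^ k := by gcongr
    _ ≤ _ := by gcongr

theorem summable_chainEntropy :
    Summable fun k : ℕ => chainEntropy (k + 1) * (1 / 2 ^ (k + 2)) := by
  refine Summable.of_nonneg_of_le (fun k => mul_nonneg (chainEntropy_nonneg _) (by positivity))
    (fun k => chainEntropy_succ_mul_le ?_) summable_succ_mul_pow_half
  rw [one_div_pow]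
  exact one_div_le_one_div_of_le (by positivity) (pow_le_pow_right₀ (by norm_num) (by omega))

/-- The odd numbers in `[1, n]`. -/
def oddsUpTo (n : ℕ) : Finset ℕ := (Finset.Icc 1 n).filter (¬ 2 ∣ ·)

theorem card_oddsUpTo (n : ℕ) : (oddsUpTo n).card = (n + 1) / 2 := by
  induction n with
  | zero => simp [oddsUpTo]
  | succ n ih =>
    have hnot : n + 1 ∉ (Finset.Icc 1 n).filter (¬ 2 ∣ ·) := by simp
    rw [oddsUpTo, ← Finset.insert_Icc_right_eq_Icc_add_one (by omega), Finset.filter_insert]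
    unfold oddsUpTo at ih
    split_ifs with h
    · rw [ih]; omega
    · rw [Finset.card_insert_of_notMem hnot, ih]; omega

/-- The number of maximal chains `j, 2j, 4j, …` of length `k + 1` in `[1, n]`. -/
def chainNumber (n k : ℕ) : ℕ := ((oddsUpTo n).filter fun j => Nat.size (n / j) = k + 1).card

/-- The chain from `j` has more than `k` elements exactly when `j ≤ n / 2 ^ k`, so exact length is a
difference of two counts of odd numbers. -/
theorem chainNumber_eq (n k : ℕ) :
    (chainNumber n k : ℝ) = (((n / 2 ^ k + 1) / 2 : ℕ) : ℝ) - ((n / 2 ^ (k + 1) + 1) / 2 : ℕ) := by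
  have hsub : oddsUpTo (n / 2 ^ (k + 1)) ⊆ oddsUpTo (n / 2 ^ k) :=
    Finset.filter_subset_filter _ (Finset.Icc_subset_Icc_right
      (Nat.div_le_div_left (Nat.pow_le_pow_right (by norm_num) (by omega)) (by positivity)))
  have h : (oddsUpTo n).filter (fun j => Nat.size (n / j) = k + 1) =
      oddsUpTo (n / 2 ^ k) \ oddsUpTo (n / 2 ^ (k + 1)) := by
    ext j
    have e : ∀ i, 1 ≤ j → (2 ^ i ≤ n / j ↔ j ≤ n / 2 ^ i) := fun i hj => by
      rw [Nat.le_div_iff_mul_le hj, Nat.le_div_iff_mul_le (by positivity), mul_comm]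
    have hle : n / 2 ^ k ≤ n := Nat.div_le_self _ _
    have e1 : Nat.size (n / j) = k + 1 ↔ 2 ^ k ≤ n / j ∧ ¬ 2 ^ (k + 1) ≤ n / j := by
      rw [not_le, ← Nat.size_le, ← Nat.lt_size]; omega
    simp only [oddsUpTo, Finset.mem_filter, Finset.mem_Icc, Finset.mem_sdiff, e1]
    constructor
    · rintro ⟨⟨⟨h1, h2⟩, h3⟩, h4, h5⟩
      rw [e _ h1] at h4 h5
      exact ⟨⟨⟨h1, h4⟩, h3⟩, fun h => h5 h.1.2⟩
    · rintro ⟨⟨⟨h1, h2⟩, h3⟩, h4⟩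
      rw [e _ h1, e _ h1]
      exact ⟨⟨⟨h1, h2.trans hle⟩, h3⟩, h2, fun h => h4 ⟨⟨h1, h⟩, h3⟩⟩
  rw [chainNumber, h, Finset.cast_card_sdiff hsub, card_oddsUpTo, card_oddsUpTo]

theorem abs_half_floor_sub_le (n m : ℕ) (hm : 0 < m) :
    |(((n / m + 1) / 2 : ℕ) : ℝ) - n / m / 2| ≤ 1 := by
  have hm' : (0 : ℝ) < m := by exact_mod_cast hm
  have h1 : ((n / m : ℕ) : ℝ) ≤ n / m := Nat.cast_div_le
  have h2 : (n : ℝ) / m < (n / m : ℕ) + 1 := by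
    rw [div_lt_iff₀ hm']
    exact_mod_cast Nat.lt_mul_of_div_lt (Nat.lt_succ_self _) hm
  generalize (n : ℝ) / m = x at *
  generalize n / m = a at *
  have h3 : (a : ℝ) ≤ 2 * ((a + 1) / 2 : ℕ) := by exact_mod_cast (by omega : a ≤ 2 * ((a + 1) / 2))
  have h4 : 2 * (((a + 1) / 2 : ℕ) : ℝ) ≤ a + 1 := by
    exact_mod_cast (by omega : 2 * ((a + 1) / 2) ≤ a + 1)
  rw [abs_le]; constructor <;> linarith

theorem abs_chainNumber_sub_le (n k : ℕ) : |(chainNumber n k : ℝ) - n * (1 / 2 ^ (k + 2))| ≤ 2 := by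
  have h1 := abs_le.1 (abs_half_floor_sub_le n (2 ^ k) (by positivity))
  have h2 := abs_le.1 (abs_half_floor_sub_le n (2 ^ (k + 1)) (by positivity))
  have e : (n : ℝ) * (1 / 2 ^ (k + 2)) =
      n / (2 ^ k : ℕ) / 2 - n / (2 ^ (k + 1) : ℕ) / 2 := by
    push_cast; field_simp; ring
  rw [chainNumber_eq, e, abs_le]
  constructor <;> linarith [h1.1, h1.2, h2.1, h2.2]

/-- A bound with no additive error: after division by `n` it is summable against `chainEntropy`
uniformly in `n`, as dominated convergence requires. -/
theorem chainNumber_le (n k : ℕ) : (chainNumber n k : ℝ) ≤ n * (1 / 2) ^ k := by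
  have h : chainNumber n k ≤ n / 2 ^ k := by
    have h1 : (chainNumber n k : ℝ) ≤ ((n / 2 ^ k + 1) / 2 : ℕ) := by
      rw [chainNumber_eq]; linarith [Nat.cast_nonneg (α := ℝ) ((n / 2 ^ (k + 1) + 1) / 2)]
    have h2 : chainNumber n k ≤ (n / 2 ^ k + 1) / 2 := by exact_mod_cast h1
    generalize n / 2 ^ k = a at *
    omega
  calc (chainNumber n k : ℝ) ≤ ((n / 2 ^ k : ℕ) : ℝ) := by exact_mod_cast h
    _ ≤ n / (2 ^ k : ℕ) := Nat.cast_div_le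
    _ = _ := by push_cast; rw [one_div_pow]; ring

theorem logb_card_goldenWords (n : ℕ) :
    Real.logb 2 (goldenWords n).card = ∑' k : ℕ, chainEntropy (k + 1) * chainNumber n k := by
  have hsize : ∀ j ∈ oddsUpTo n, Nat.size (n / j) - 1 ∈ Finset.range n ∧
      Nat.size (n / j) - 1 + 1 = Nat.size (n / j) := by
    intro j hj
    simp only [oddsUpTo, Finset.mem_filter, Finset.mem_Icc] at hj
    have h0 : 0 < Nat.size (n / j) := Nat.size_pos.2 (Nat.div_pos hj.1.2 hj.1.1)
    have h1 : Nat.size (n / j) ≤ n := Nat.size_le.2 (lt_of_le_of_lt (Nat.div_le_self _ _) Nat.lt_two_pow_self)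
    simp only [Finset.mem_range]; omega
  have h1 : Real.logb 2 (goldenWords n).card =
      ∑ j ∈ oddsUpTo n, chainEntropy (Nat.size (n / j)) := by
    rw [card_goldenWords]; push_cast
    rw [Real.logb_prod _ _ fun j _ => by have := chainCount_pos n j; positivity]
    rfl
  rw [h1, ← Finset.sum_fiberwise_of_maps_to (t := Finset.range n)
    (g := fun j => Nat.size (n / j) - 1) fun j hj => (hsize j hj).1, tsum_eq_sum (s := Finset.range n)]
  · refine Finset.sum_congr rfl fun k _ => ?_
    have e : (oddsUpTo n).filter (fun j => Nat.size (n / j) - 1 = k) =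
        (oddsUpTo n).filter (fun j => Nat.size (n / j) = k + 1) :=
      Finset.filter_congr fun j hj => by have := (hsize j hj).2; omega
    rw [e, Finset.sum_congr rfl fun j hj => by rw [(Finset.mem_filter.1 hj).2], Finset.sum_const,
      nsmul_eq_mul, mul_comm]
    rfl
  · intro k hk
    have : chainNumber n k = 0 := by
      rw [chainNumber, Finset.card_eq_zero, Finset.filter_eq_empty_iff]
      intro j hj h
      have := hsize j hj
      rw [h] at this
      exact hk (by simpa using this.1)
    simp [this]

theorem tendsto_logb_card_goldenWords :
    Tendsto (fun n : ℕ => Real.logb 2 (goldenWords n).card / n) atTop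
      (𝓝 (∑' k : ℕ, chainEntropy (k + 1) * (1 / 2 ^ (k + 2)))) := by
  have h := tendsto_tsum_of_dominated_convergence (𝓕 := atTop)
    (f := fun n k : ℕ => chainEntropy (k + 1) * ((chainNumber n k : ℝ) / n))
    (g := fun k : ℕ => chainEntropy (k + 1) * (1 / 2 ^ (k + 2)))
    summable_succ_mul_pow_half (fun k => ?_) (Eventually.of_forall fun n k => ?_)
  · refine h.congr fun n => ?_
    rw [logb_card_goldenWords, ← tsum_div_const]
    simp only [mul_div_assoc]
  · refine Tendsto.const_mul _ ?_
    rw [tendsto_iff_norm_sub_tendsto_zero]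
    refine squeeze_zero' (Eventually.of_forall fun _ => norm_nonneg _) ?_
      (tendsto_const_div_atTop_nhds_zero_nat 2)
    filter_upwards [eventually_gt_atTop 0] with n hn
    have hn' : (0 : ℝ) < n := by exact_mod_cast hn
    have e : (chainNumber n k : ℝ) / n - 1 / 2 ^ (k + 2) =
        (chainNumber n k - n * (1 / 2 ^ (k + 2))) / n := by field_simp
    rw [e, norm_div, Real.norm_of_nonneg hn'.le]
    exact div_le_div_of_nonneg_right (abs_chainNumber_sub_le n k) hn'.le
  · have h0 : (0 : ℝ) ≤ chainNumber n k / n := by positivity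
    rw [Real.norm_of_nonneg (mul_nonneg (chainEntropy_nonneg _) h0)]
    refine chainEntropy_succ_mul_le ?_
    rcases Nat.eq_zero_or_pos n with rfl | hn
    · simp
    · have hn' : (0 : ℝ) < n := by exact_mod_cast hn
      rw [div_le_iff₀ hn', mul_comm]
      exact chainNumber_le n k

/-! ### Dyadic values of words and prefixes of points -/

/-- The real number whose binary digits `1` are at the positions in `A`. -/
noncomputable def binaryValue (A : Finset ℕ) : ℝ := ∑ k ∈ A, (1 / 2 ^ k : ℝ)

/-- The word of length `n` as an integer. -/
def binaryCode (n : ℕ) (A : Finset ℕ) : ℕ := ∑ k ∈ A, 2 ^ (n - k)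

theorem binaryCode_eq {n : ℕ} {A : Finset ℕ} (hA : A ⊆ Finset.Icc 1 n) :
    (binaryCode n A : ℝ) = binaryValue A * 2 ^ n := by
  rw [binaryCode, binaryValue, Finset.sum_mul]
  push_cast
  refine Finset.sum_congr rfl fun k hk => ?_
  have := (Finset.mem_Icc.1 (hA hk)).2
  rw [pow_sub₀ _ (by norm_num) this]
  ring

/-- The reflection `k ↦ n - k` turns the code into an ordinary binary expansion, which determines
its set of exponents. -/
theorem binaryCode_injOn (n : ℕ) : Set.InjOn (binaryCode n) {A | A ⊆ Finset.Icc 1 n} := by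
  have h : ∀ A ∈ {A | A ⊆ Finset.Icc 1 n}, Set.InjOn (fun k => n - k) (A : Set ℕ) := by
    intro A hA a ha b hb hab
    have h1 := (Finset.mem_Icc.1 (hA ha)).2
    have h2 := (Finset.mem_Icc.1 (hA hb)).2
    simp only at hab
    omega
  have hrec : ∀ A ∈ {A | A ⊆ Finset.Icc 1 n}, (A.image fun k => n - k).image (fun k => n - k) = A := by
    intro A hA
    rw [Finset.image_image]
    conv_rhs => rw [← Finset.image_id (s := A)]
    refine Finset.image_congr fun k hk => ?_
    have h1 := (Finset.mem_Icc.1 (hA hk)).2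
    simp only [Function.comp, id]
    omega
  intro A hA B hB hAB
  have hs : ∀ A ∈ {A | A ⊆ Finset.Icc 1 n},
      binaryCode n A = ∑ i ∈ A.image (fun k => n - k), 2 ^ i := fun A hA =>
    (Finset.sum_image (f := fun i => 2 ^ i) (h A hA)).symm
  have h2 := Finset.geomSum_injective le_rfl ((hs A hA).symm.trans (hAB.trans (hs B hB)))
  rw [← hrec A hA, h2, hrec B hB]

theorem goldenWords_subset {n : ℕ} {A : Finset ℕ} (hA : A ∈ goldenWords n) : A ⊆ Finset.Icc 1 n :=
  Finset.mem_powerset.1 (Finset.mem_filter.1 hA).1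

theorem le_abs_binaryValue_sub {n : ℕ} {A B : Finset ℕ} (hA : A ∈ goldenWords n)
    (hB : B ∈ goldenWords n) (hAB : A ≠ B) : 1 / 2 ^ n ≤ |binaryValue A - binaryValue B| := by
  have hA' := goldenWords_subset hA
  have hB' := goldenWords_subset hB
  have hne : (binaryCode n A : ℤ) - binaryCode n B ≠ 0 := fun h =>
    hAB (binaryCode_injOn n hA' hB' (by omega))
  have h1 : (1 : ℝ) ≤ |(binaryCode n A : ℝ) - binaryCode n B| := by
    exact_mod_cast Int.one_le_abs hne
  rw [binaryCode_eq hA', binaryCode_eq hB', ← sub_mul, abs_mul, abs_of_pos (a := (2 : ℝ) ^ n)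
    (by positivity)] at h1
  rwa [div_le_iff₀ (by positivity)]

/-- Few words of length `n` have their value in a given short interval. -/
theorem card_goldenWords_filter_le (n : ℕ) (a : ℝ) (L : ℕ) :
    ((goldenWords n).filter fun A => binaryValue A ∈ Set.Icc a (a + L / 2 ^ n)).card ≤ L + 1 := by
  have h := Finset.card_le_card_of_injOn (s := (goldenWords n).filter fun A =>
      binaryValue A ∈ Set.Icc a (a + L / 2 ^ n)) (t := Finset.Icc ⌈a * 2 ^ n⌉ (⌈a * 2 ^ n⌉ + L))
    (fun A => (binaryCode n A : ℤ)) ?_ ?_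
  · rw [Int.card_Icc] at h
    refine h.trans (le_of_eq ?_)
    omega
  · intro A hA
    simp only [Finset.coe_filter, Set.mem_ofPred_eq, Set.mem_Icc] at hA
    obtain ⟨hA, h1, h2⟩ := hA
    have e := binaryCode_eq (goldenWords_subset hA)
    have h3 : a * 2 ^ n ≤ binaryCode n A := by rw [e]; gcongr
    have h4 : (binaryCode n A : ℝ) ≤ a * 2 ^ n + L := by
      rw [e]
      calc binaryValue A * 2 ^ n ≤ (a + L / 2 ^ n) * 2 ^ n := by gcongr
        _ = _ := by field_simp
    simp only [Finset.coe_Icc, Set.mem_Icc]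
    refine ⟨Int.ceil_le.2 (by exact_mod_cast h3), ?_⟩
    have h5 := Int.le_ceil (a * 2 ^ n)
    exact_mod_cast h4.trans (add_le_add_left h5 _)
  · intro A hA B hB hAB
    simp only [Finset.coe_filter, Set.mem_ofPred_eq] at hA hB
    exact binaryCode_injOn n (goldenWords_subset hA.1) (goldenWords_subset hB.1) (by simpa using hAB)

/-- A word may be continued by zeros without violating the constraint. -/
theorem binaryValue_mem {n : ℕ} {A : Finset ℕ} (hA : A ∈ goldenWords n) :
    binaryValue A ∈ multGoldenMeanSet := by
  classical
  have hA' := (Finset.mem_filter.1 hA).2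
  refine ⟨fun k => if k ∈ A then 1 else 0, fun k _ => ?_, fun k _ => ?_, ?_⟩
  · by_cases h : k ∈ A <;> simp [h]
  · by_cases h : k ∈ A
    · simp [hA' k h]
    · simp [h]
  · have h0 : (0 : ℕ) ∉ A := fun h => by simpa using (Finset.mem_Icc.1 (goldenWords_subset hA h)).1
    have h1 : HasSum (fun k : ℕ => if k ∈ A then (1 / 2 ^ k : ℝ) else 0) (binaryValue A) := by
      have := hasSum_sum_of_ne_finset_zero (s := A) (L := .unconditional ℕ)
        (f := fun k : ℕ => if k ∈ A then (1 / 2 ^ k : ℝ) else 0) fun k hk => by simp [hk]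
      rwa [Finset.sum_congr rfl fun k hk => if_pos hk] at this
    rw [← hasSum_nat_add_iff' 1] at h1
    simp only [Finset.sum_range_one, h0, if_false, sub_zero] at h1
    have e : (fun k : ℕ => ((if k + 1 ∈ A then 1 else 0 : ℕ) : ℝ) / 2 ^ (k + 1)) =
        fun k : ℕ => if k + 1 ∈ A then (1 / 2 ^ (k + 1) : ℝ) else 0 := by
      funext k; split_ifs <;> simp
    rw [e]; exact h1

/-- The first `n` digits of the sequence `x`, as a word. -/
def onesUpTo (x : ℕ → ℕ) (n : ℕ) : Finset ℕ := (Finset.Icc 1 n).filter (x · = 1)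

theorem onesUpTo_mem {x : ℕ → ℕ} (hx : ∀ k, 1 ≤ k → x k * x (2 * k) = 0) (n : ℕ) :
    onesUpTo x n ∈ goldenWords n := by
  refine Finset.mem_filter.2 ⟨Finset.mem_powerset.2 (Finset.filter_subset _ _), ?_⟩
  intro k hk h2k
  simp only [onesUpTo, Finset.mem_filter, Finset.mem_Icc] at hk h2k
  simpa [hk.2, h2k.2] using hx k hk.1.1

theorem binaryValue_onesUpTo_mem {x : ℕ → ℕ} (hx : ∀ k, 1 ≤ k → x k = 0 ∨ x k = 1) {t : ℝ}
    (ht : HasSum (fun n : ℕ => (x (n + 1) : ℝ) / 2 ^ (n + 1)) t) (n : ℕ) :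
    binaryValue (onesUpTo x n) ≤ t ∧ t ≤ binaryValue (onesUpTo x n) + 1 / 2 ^ n := by
  have e : ∑ i ∈ Finset.range n, (x (i + 1) : ℝ) / 2 ^ (i + 1) = binaryValue (onesUpTo x n) := by
    rw [binaryValue, onesUpTo, Finset.sum_filter, Finset.range_eq_Ico,
      Finset.sum_Ico_add' (fun k => (x k : ℝ) / 2 ^ k) 0 n 1, zero_add]
    have : Finset.Ico 1 (n + 1) = Finset.Icc 1 n := by ext; simp
    rw [this]
    refine Finset.sum_congr rfl fun k hk => ?_
    rcases hx k (Finset.mem_Icc.1 hk).1 with h | h <;> simp [h]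
  have h1 := (hasSum_nat_add_iff' n).2 ht
  rw [e] at h1
  -- The largest possible tail has all digits 1 and sums to `1 / 2 ^ n`.
  have h2 : HasSum (fun i : ℕ => (1 : ℝ) / 2 ^ n * ((1 / 2) * (1 / 2) ^ i)) (1 / 2 ^ n) := by
    have := ((hasSum_geometric_of_lt_one (r := (1 / 2 : ℝ)) (by norm_num) (by norm_num)).mul_left
      (1 / 2)).mul_left (1 / 2 ^ n)
    rwa [show (1 / 2 ^ n : ℝ) * (1 / 2 * (1 - 1 / 2)⁻¹) = 1 / 2 ^ n by norm_num] at this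
  have h3 := h1.nonneg fun i => by positivity
  have h4 := hasSum_le (fun i => ?_) h1 h2
  · constructor <;> linarith
  · have : (x (i + n + 1) : ℝ) ≤ 1 := by rcases hx (i + n + 1) (by omega) with h | h <;> simp [h]
    calc (x (i + n + 1) : ℝ) / 2 ^ (i + n + 1) ≤ 1 / 2 ^ (i + n + 1) := by gcongr
      _ = _ := by rw [one_div_pow]; field_simp; ring

/-! ### Covering numbers and the Minkowski dimension -/

theorem multGoldenMeanSet_nonempty : multGoldenMeanSet.Nonempty :=
  ⟨_, binaryValue_mem (n := 0) (A := ∅) (by simp [goldenWords])⟩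

theorem multGoldenMeanSet_subset_Icc : multGoldenMeanSet ⊆ Set.Icc 0 1 := by
  rintro t ⟨x, hx, -, ht⟩
  simpa [onesUpTo, binaryValue] using binaryValue_onesUpTo_mem hx ht 0

theorem totallyBounded_multGoldenMeanSet : TotallyBounded multGoldenMeanSet :=
  isCompact_Icc.totallyBounded.subset multGoldenMeanSet_subset_Icc

theorem goldenWords_card_pos (n : ℕ) : 0 < (goldenWords n).card :=
  Finset.card_pos.2 ⟨∅, by simp [goldenWords]⟩

theorem externalCoveringNumber_le_card {n : ℕ} {ε : ℝ≥0} (hε : 1 / 2 ^ n ≤ (ε : ℝ)) :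
    Metric.externalCoveringNumber ε multGoldenMeanSet ≤ (goldenWords n).card := by
  classical
  have hc : Metric.IsCover ε multGoldenMeanSet ((goldenWords n).image binaryValue : Set ℝ) := by
    rintro t ⟨x, hx, hx2, ht⟩
    have h := binaryValue_onesUpTo_mem hx ht n
    refine ⟨binaryValue (onesUpTo x n), ?_, ?_⟩
    · exact Finset.mem_coe.2 (Finset.mem_image_of_mem _ (onesUpTo_mem hx2 n))
    · change edist _ _ ≤ _
      rw [edist_nndist, ENNReal.coe_le_coe, ← NNReal.coe_le_coe, coe_nndist,
        Real.dist_eq, abs_le]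
      constructor <;> linarith
  refine hc.externalCoveringNumber_le_encard.trans ?_
  rw [Set.encard_coe_eq_coe_finsetCard]
  exact_mod_cast Finset.card_image_le

/-- Values of distinct words are at least `1 / 2 ^ n` apart, so a ball of diameter less than that
contains at most one of them. -/
theorem card_le_externalCoveringNumber {n : ℕ} {ε : ℝ≥0} (hε : 2 * (ε : ℝ) < 1 / 2 ^ n) :
    ((goldenWords n).card : ℕ∞) ≤ Metric.externalCoveringNumber ε multGoldenMeanSet := by
  refine le_iInf₂ fun C hC => ?_
  have h : ∀ A ∈ (goldenWords n : Set (Finset ℕ)), ∃ c ∈ C, |binaryValue A - c| ≤ ε := by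
    intro A hA
    obtain ⟨c, hc, hAc⟩ := hC (binaryValue_mem (Finset.mem_coe.1 hA))
    change edist _ _ ≤ _ at hAc
    rw [edist_nndist, ENNReal.coe_le_coe, ← NNReal.coe_le_coe, coe_nndist,
        Real.dist_eq] at hAc
    exact ⟨c, hc, hAc⟩
  choose! f hf using h
  rw [← Set.encard_coe_eq_coe_finsetCard]
  refine Set.encard_le_encard_of_injOn (f := f) (fun A hA => (hf A hA).1) ?_
  intro A hA B hB hAB
  by_contra hne
  have h1 := le_abs_binaryValue_sub hA hB hne
  have h2 := (hf A hA).2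
  have h3 := (hf B hB).2
  rw [← hAB, abs_sub_comm] at h3
  have h4 := abs_sub_le (binaryValue A) (f A) (binaryValue B)
  linarith

theorem hasMinkowskiDim_multGoldenMeanSet :
    HasMinkowskiDim multGoldenMeanSet (∑' k : ℕ, chainEntropy (k + 1) * (1 / 2 ^ (k + 2))) := by
  refine ⟨multGoldenMeanSet_nonempty, totallyBounded_multGoldenMeanSet, ?_⟩
  have hlim := tendsto_logb_card_goldenWords
  generalize ∑' k : ℕ, chainEntropy (k + 1) * (1 / 2 ^ (k + 2)) = d at *
  -- The covering number lies between the numbers of words of lengths `n ε - 2` and `n ε`. The shift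
  -- by 2 secures the strict inequality `2ε < 1 / 2 ^ (n ε - 2)`, as `n ε - 1 < logb 2 (1 / ε)`.
  set n : ℝ≥0 → ℕ := fun ε => ⌈Real.logb 2 (1 / (ε : ℝ))⌉₊ with hn
  have hlog : Tendsto (fun ε : ℝ≥0 => Real.logb 2 (1 / (ε : ℝ))) (𝓝[>] 0) atTop := by
    refine (Real.tendsto_logb_atTop (by norm_num)).comp ?_
    simp only [one_div]
    refine tendsto_inv_nhdsGT_zero.comp ?_
    refine tendsto_nhdsWithin_iff.2 ⟨?_, ?_⟩
    · exact (NNReal.continuous_coe.tendsto' 0 0 rfl).mono_left nhdsWithin_le_nhds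
    · filter_upwards [self_mem_nhdsWithin] with ε hε
      exact_mod_cast hε
  have hnt : Tendsto n (𝓝[>] 0) atTop := tendsto_nat_ceil_atTop.comp hlog
  have hratio : Tendsto (fun ε : ℝ≥0 => (n ε : ℝ) / Real.logb 2 (1 / (ε : ℝ))) (𝓝[>] 0) (𝓝 1) :=
    (tendsto_nat_ceil_div_atTop (R := ℝ)).comp hlog
  have hup : Tendsto (fun ε : ℝ≥0 => Real.logb 2 (goldenWords (n ε)).card / n ε *
      (n ε / Real.logb 2 (1 / (ε : ℝ)))) (𝓝[>] 0) (𝓝 d) := by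
    simpa using (hlim.comp hnt).mul hratio
  have hlo : Tendsto (fun ε : ℝ≥0 => Real.logb 2 (goldenWords (n ε - 2)).card / (n ε - 2 : ℕ) *
      ((n ε - 2 : ℕ) / n ε * (n ε / Real.logb 2 (1 / (ε : ℝ))))) (𝓝[>] 0) (𝓝 d) := by
    have h1 : Tendsto (fun n : ℕ => ((n - 2 : ℕ) : ℝ) / n) atTop (𝓝 1) := by
      have : Tendsto (fun n : ℕ => 1 - (2 : ℝ) / n) atTop (𝓝 1) := by
        simpa using tendsto_const_nhds.sub (tendsto_const_div_atTop_nhds_zero_nat (2 : ℝ))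
      refine this.congr' ?_
      filter_upwards [eventually_ge_atTop 2] with n hn
      have : (n : ℝ) ≠ 0 := by positivity
      rw [Nat.cast_sub hn]; push_cast; field_simp
    simpa using ((hlim.comp (tendsto_sub_atTop_nat 2)).comp hnt).mul
      ((h1.comp hnt).mul hratio)
  have hconv : ∀ a b : ℝ, Real.log a / Real.log b = Real.logb 2 a / Real.logb 2 b := by
    intro a b
    have : Real.log 2 ≠ 0 := by positivity
    rw [← Real.log_div_log, ← Real.log_div_log, div_div_div_cancel_right₀ this]
  have hpos : ∀ᶠ ε : ℝ≥0 in 𝓝[>] 0, 0 < ε := self_mem_nhdsWithin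
  refine tendsto_of_tendsto_of_tendsto_of_le_of_le' hlo hup ?_ ?_
  · filter_upwards [hpos, hnt.eventually_ge_atTop 3, hlog.eventually_gt_atTop 0] with ε hε hn3 hl
    have hε' : (0 : ℝ) < ε := hε
    have hN : Metric.externalCoveringNumber ε multGoldenMeanSet ≠ ⊤ := by
      obtain ⟨m, hm⟩ := exists_pow_lt_of_lt_one hε' (by norm_num : (1 / 2 : ℝ) < 1)
      refine ne_top_of_le_ne_top ?_ (externalCoveringNumber_le_card (n := m) ?_)
      · exact ENat.natCast_ne_top _
      · rw [← one_div_pow]; exact hm.le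
    have h2 : 2 * (ε : ℝ) < 1 / 2 ^ (n ε - 2) := by
      have h := Nat.ceil_lt_add_one hl.le
      have h' : ((n ε - 2 : ℕ) : ℝ) + 1 < Real.logb 2 (1 / (ε : ℝ)) := by
        rw [Nat.cast_sub (by omega)]; push_cast; linarith
      rw [Real.lt_logb_iff_rpow_lt (by norm_num) (by positivity)] at h'
      rw [show ((n ε - 2 : ℕ) : ℝ) + 1 = ((n ε - 2 + 1 : ℕ) : ℝ) by push_cast; ring,
        Real.rpow_natCast, pow_succ, lt_div_iff₀ hε'] at h'
      rw [lt_div_iff₀ (by positivity)]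
      linarith
    have hle := ENat.toNat_le_toNat (card_le_externalCoveringNumber h2) hN
    rw [ENat.toNat_natCast] at hle
    have hc := goldenWords_card_pos (n ε - 2)
    have hle' : Real.logb 2 (goldenWords (n ε - 2)).card ≤
        Real.logb 2 (Metric.externalCoveringNumber ε multGoldenMeanSet).toNat :=
      Real.logb_le_logb_of_le (by norm_num) (by exact_mod_cast hc) (by exact_mod_cast hle)
    have hn0 : ((n ε - 2 : ℕ) : ℝ) ≠ 0 := by
      have : n ε - 2 ≠ 0 := by omega
      exact_mod_cast this
    have hn1 : (n ε : ℝ) ≠ 0 := by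
      have : n ε ≠ 0 := by omega
      exact_mod_cast this
    rw [hconv, ← mul_assoc, div_mul_div_cancel₀ hn0, div_mul_div_cancel₀ hn1]
    exact div_le_div_of_nonneg_right hle' hl.le
  · filter_upwards [hpos, hnt.eventually_ge_atTop 3, hlog.eventually_gt_atTop 0] with ε hε hn3 hl
    have hε' : (0 : ℝ) < ε := hε
    have h2 : 1 / 2 ^ (n ε) ≤ (ε : ℝ) := by
      have h := Nat.le_ceil (Real.logb 2 (1 / (ε : ℝ)))
      rw [Real.logb_le_iff_le_rpow (by norm_num) (by positivity), Real.rpow_natCast] at h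
      rwa [one_div_le (by positivity) hε']
    have hle := ENat.toNat_le_toNat (externalCoveringNumber_le_card h2) (ENat.natCast_ne_top _)
    rw [ENat.toNat_natCast] at hle
    have hc := goldenWords_card_pos (n ε)
    have hn1 : (n ε : ℝ) ≠ 0 := by
      have : n ε ≠ 0 := by omega
      exact_mod_cast this
    rw [hconv, div_mul_div_cancel₀ hn1]
    refine div_le_div_of_nonneg_right ?_ hl.le
    rcases Nat.eq_zero_or_pos (Metric.externalCoveringNumber ε multGoldenMeanSet).toNat with h0 | h0
    · rw [h0, Nat.cast_zero, Real.logb_zero]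
      exact Real.logb_nonneg (by norm_num) (by exact_mod_cast hc)
    · exact Real.logb_le_logb_of_le (by norm_num) (by exact_mod_cast h0) (by exact_mod_cast hle)

/-! ### Upper bound for the Hausdorff dimension -/

theorem onesUpTo_inter (x : ℕ → ℕ) {m n : ℕ} (h : m ≤ n) :
    onesUpTo x n ∩ Finset.Icc 1 m = onesUpTo x m := by
  ext k
  simp only [onesUpTo, Finset.mem_inter, Finset.mem_filter, Finset.mem_Icc]
  constructor
  · rintro ⟨⟨-, h1⟩, h2⟩; exact ⟨h2, h1⟩
  · rintro ⟨h1, h2⟩; exact ⟨⟨⟨h1.1, h1.2.trans h⟩, h2⟩, h1⟩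

theorem card_onesUpTo_le (x : ℕ → ℕ) (n : ℕ) : (onesUpTo x n).card ≤ n := by
  simpa [onesUpTo] using Finset.card_le_card (Finset.filter_subset (x · = 1) (Finset.Icc 1 n))

/-- Every bounded sequence has arbitrarily late small increments. -/
theorem exists_increment_le {a : ℕ → ℝ} (h0 : ∀ k, 0 ≤ a k) (h1 : ∀ k, a k ≤ 1) {η : ℝ}
    (hη : 0 < η) (K : ℕ) : ∃ j, a (K + j + 1) - a (K + j) ≤ η := by
  by_contra! h
  have key : ∀ j : ℕ, j * η ≤ a (K + j) := by
    intro j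
    induction j with
    | zero => simpa using h0 K
    | succ j ih =>
      have := h j
      push_cast
      rw [← add_assoc]
      linarith
  obtain ⟨j, hj⟩ := exists_nat_gt (1 / η)
  rw [div_lt_iff₀ hη] at hj
  linarith [key j, h1 (K + j)]

/-- The words of length `n` whose weight for the golden Markov chain is at least `c`. -/
noncomputable def heavyWords (p : ℝ) (n : ℕ) (c : ℝ) : Finset (Finset ℕ) :=
  (goldenWords n).filter fun A => c ≤ wordWeight (fun _ => 1 - p) (fun _ => p) 1 n A

theorem card_heavyWords_mul_le {p : ℝ} (hp0 : 0 < p) (hp1 : p < 1) (n : ℕ) (c : ℝ) :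
    (heavyWords p n c).card * c ≤ 1 := by
  rw [← sum_wordWeight_eq_one (α := fun _ => 1 - p) (β := fun _ => p) (n := n) fun m _ => by ring,
    ← sum_goldenWords_wordWeight, ← nsmul_eq_mul, ← Finset.sum_const]
  calc _ ≤ ∑ A ∈ heavyWords p n c, wordWeight (fun _ => 1 - p) (fun _ => p) 1 n A :=
        Finset.sum_le_sum fun A hA => (Finset.mem_filter.1 hA).2
    _ ≤ _ := Finset.sum_le_sum_of_subset_of_nonneg (Finset.filter_subset _ _) fun A _ _ =>
        wordWeight_nonneg (fun _ => by linarith) (fun _ => hp0.le) zero_le_one n A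

/-- With `a k` the density of ones up to `2 ^ k`, the exponent at `n = 2 ^ (k + 1)` is `n * (1 + (a
(k + 1) - a k) / 2)`. An increment of at most `2 * η` suffices. -/
theorem exists_onesUpTo_mem_heavyWords {p : ℝ} (hp0 : 0 < p) (hp1 : p < 1)
    (hp : p ^ 3 = (1 - p) ^ 2) {η : ℝ} (hη : 0 < η) {x : ℕ → ℕ}
    (hx : ∀ k, 1 ≤ k → x k * x (2 * k) = 0) (K : ℕ) :
    ∃ j, onesUpTo x (2 ^ (K + j + 1)) ∈
      heavyWords p (2 ^ (K + j + 1)) (p ^ ((2 ^ (K + j + 1) : ℝ) * (1 + η))) := by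
  obtain ⟨j, hj⟩ := exists_increment_le (a := fun k => ((onesUpTo x (2 ^ k)).card : ℝ) / 2 ^ k)
    (fun k => by positivity) (fun k => div_le_one_of_le₀
      (by exact_mod_cast card_onesUpTo_le x (2 ^ k)) (by positivity)) (η := 2 * η) (by positivity) K
  refine ⟨j, Finset.mem_filter.2 ⟨onesUpTo_mem hx _, ?_⟩⟩
  have hhalf : 2 ^ (K + j + 1) / 2 = 2 ^ (K + j) := by rw [pow_succ]; simp
  rw [wordWeight_golden hp0 hp1 hp (onesUpTo_mem hx _), hhalf,
    onesUpTo_inter x (Nat.pow_le_pow_right (by norm_num) (by omega))]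
  refine Real.rpow_le_rpow_of_exponent_ge hp0 hp1.le ?_
  push_cast
  generalize ((onesUpTo x (2 ^ (K + j + 1))).card : ℝ) = u at *
  generalize ((onesUpTo x (2 ^ (K + j))).card : ℝ) = v at *
  have h2 : (0 : ℝ) < 2 ^ (K + j) := by positivity
  simp only [pow_succ (2 : ℝ) (K + j)] at *
  generalize (2 : ℝ) ^ (K + j) = y at *
  rw [div_sub_div _ _ (by positivity) (by positivity), div_le_iff₀ (by positivity)] at hj
  nlinarith

theorem two_rpow_neg_logb {p : ℝ} (hp0 : 0 < p) (y : ℝ) :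
    p ^ y = (2 : ℝ) ^ (-(-Real.logb 2 p * y)) := by
  rw [neg_mul, neg_neg, Real.rpow_mul (by norm_num), Real.rpow_logb (by norm_num) (by norm_num) hp0]

theorem dimH_multGoldenMeanSet_le {p : ℝ} (hp0 : 0 < p) (hp1 : p < 1) (hp : p ^ 3 = (1 - p) ^ 2) :
    dimH multGoldenMeanSet ≤ ENNReal.ofReal (-Real.logb 2 p) := by
  set s := -Real.logb 2 p with hs
  have hs0 : 0 < s := by
    have := Real.logb_neg (b := 2) (by norm_num) hp0 hp1
    linarith
  refine ENNReal.le_of_forall_pos_le_add fun ε hε _ => ?_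
  have key : ENNReal.ofReal s + ε = ((s.toNNReal + ε : ℝ≥0) : ℝ≥0∞) := by
    rw [ENNReal.coe_add]; rfl
  rw [key]
  refine dimH_le_of_hausdorffMeasure_ne_top ?_
  set t : ℝ≥0 := s.toNNReal + ε with ht
  have ht' : (t : ℝ) = s + ε := by rw [ht, NNReal.coe_add, Real.coe_toNNReal _ hs0.le]
  -- Half of the excess `ε` over `s` pays for `η`; the other half, `δ`, makes the series over `j`
  -- converge.
  set η : ℝ := ε / (2 * s) with hη
  set δ : ℝ := ε / 2 with hδ
  have hε' : (0 : ℝ) < ε := hε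
  have hη0 : 0 < η := by positivity
  have hsη : s * (1 + η) = t - δ := by rw [ht', hη, hδ]; field_simp; ring
  let N : ℕ → ℕ → ℕ := fun K j => 2 ^ (K + j + 1)
  let H : ℕ → ℕ → Finset (Finset ℕ) := fun K j =>
    heavyWords p (N K j) (p ^ ((2 ^ (K + j + 1) : ℝ) * (1 + η)))
  have hdiam : ∀ n A, Metric.ediam (Set.Icc (binaryValue A) (binaryValue A + 1 / 2 ^ n)) =
      ENNReal.ofReal ((1 / 2) ^ n) := by
    intro n A
    rw [Real.ediam_Icc, add_sub_cancel_left, one_div_pow]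
  have hle : ∀ K j, K ≤ N K j ∧ j ≤ N K j := fun K j => by
    have : K + j + 1 < N K j := Nat.lt_two_pow_self
    omega
  -- This geometric series bounds the cost of the cover by heavy words of lengths `2 ^ (K + j + 1)`,
  -- independently of `K`.
  have hC : ∑' j : ℕ, ENNReal.ofReal (((2 : ℝ) ^ (-δ)) ^ j) ≠ ⊤ := by
    refine Summable.tsum_ofReal_ne_top (summable_geometric_of_lt_one (by positivity) ?_)
    exact Real.rpow_lt_one_of_one_lt_of_neg (by norm_num) (by simp [hδ, hε'])
  have hbound := MeasureTheory.Measure.hausdorffMeasure_le_liminf_tsum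
    (ι := fun K => Σ j : ℕ, {A // A ∈ H K j}) (t : ℝ) multGoldenMeanSet (l := atTop)
    (fun K : ℕ => ENNReal.ofReal ((1 / 2) ^ K)) ?_
    (fun K i => Set.Icc (binaryValue i.2.1) (binaryValue i.2.1 + 1 / 2 ^ (N K i.1))) ?_ ?_
  · refine ne_top_of_le_ne_top hC (hbound.trans ?_)
    refine (liminf_le_liminf (v := fun _ => ∑' j : ℕ, ENNReal.ofReal (((2 : ℝ) ^ (-δ)) ^ j))
      (Eventually.of_forall fun K => ?_)).trans (liminf_const _).le
    simp only [hdiam]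
    rw [ENNReal.tsum_sigma']
    refine ENNReal.tsum_le_tsum fun j => ?_
    dsimp only
    rw [tsum_fintype, Finset.sum_const, Finset.card_univ, Fintype.card_coe, nsmul_eq_mul,
      ENNReal.ofReal_rpow_of_nonneg (by positivity) t.coe_nonneg, ← ENNReal.ofReal_natCast,
      ← ENNReal.ofReal_mul (by positivity)]
    refine ENNReal.ofReal_le_ofReal ?_
    have h1 := card_heavyWords_mul_le hp0 hp1 (N K j) (p ^ ((2 ^ (K + j + 1) : ℝ) * (1 + η)))
    have hN : (2 ^ (K + j + 1) : ℝ) = (N K j : ℕ) := by simp [N]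
    have e1 : p ^ ((2 ^ (K + j + 1) : ℝ) * (1 + η)) = (2 : ℝ) ^ (-((t - δ) * N K j)) := by
      rw [two_rpow_neg_logb hp0, ← hs, hN, ← hsη]; congr 1; ring
    have e2 : (((1 / 2 : ℝ) ^ (N K j)) ^ (t : ℝ)) =
        (2 : ℝ) ^ (-((t - δ) * N K j)) * 2 ^ (-δ * N K j) := by
      rw [← Real.rpow_add (by norm_num), one_div, inv_pow, ← Real.rpow_natCast,
        ← Real.rpow_neg (by norm_num), ← Real.rpow_mul (by norm_num)]
      congr 1; ring
    change ((H K j).card : ℝ) * p ^ ((2 ^ (K + j + 1) : ℝ) * (1 + η)) ≤ 1 at h1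
    rw [e1] at h1
    rw [e2, ← mul_assoc]
    calc _ ≤ 1 * (2 : ℝ) ^ (-δ * N K j) := by gcongr
      _ ≤ (2 : ℝ) ^ (-δ * j) := by
        rw [one_mul]
        refine Real.rpow_le_rpow_of_exponent_le (by norm_num) ?_
        have : (j : ℝ) ≤ N K j := by exact_mod_cast (hle K j).2
        nlinarith [show 0 < δ by positivity]
      _ = _ := by rw [Real.rpow_mul (by norm_num), Real.rpow_natCast]
  · rw [← ENNReal.ofReal_zero]
    exact ENNReal.tendsto_ofReal (tendsto_pow_atTop_nhds_zero_of_lt_one (by norm_num) (by norm_num))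
  · refine Eventually.of_forall fun K i => ?_
    rw [hdiam]
    exact ENNReal.ofReal_le_ofReal
      (pow_le_pow_of_le_one (by norm_num) (by norm_num) (hle K i.1).1)
  · refine Eventually.of_forall fun K => ?_
    rintro y ⟨x, hx, hx2, hy⟩
    obtain ⟨j, hj⟩ := exists_onesUpTo_mem_heavyWords hp0 hp1 hp hη0 hx2 K
    exact Set.mem_iUnion.2 ⟨⟨j, ⟨_, hj⟩⟩, binaryValue_onesUpTo_mem hx hy _⟩

/-! ### Large deviations for the golden Markov chain -/

/-- The centred increment at the position `m` of the number of ones in the word `A`. -/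
noncomputable def onesIncrement (p : ℝ) (A : Finset ℕ) (m : ℕ) : ℝ :=
  if 2 ∣ m ∧ m / 2 ∈ A then 0 else (if m ∈ A then 1 else 0) - (1 - p)

/-- The compensated number of ones among the first `n` digits. -/
noncomputable def onesMartingale (p : ℝ) (n : ℕ) (A : Finset ℕ) : ℝ :=
  ∑ m ∈ Finset.Icc 1 n, onesIncrement p A m

/-- The compensator is `1 - p` at each position not forced to be 0, and `|A ∩ [1, n / 2]|` positions
are forced. -/
theorem onesMartingale_eq (p : ℝ) {n : ℕ} {A : Finset ℕ} (hA : A ∈ goldenWords n) :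
    onesMartingale p n A =
      A.card - (1 - p) * (n - ((A ∩ Finset.Icc 1 (n / 2)).card : ℝ)) := by
  have hA' := (Finset.mem_filter.1 hA).2
  have hsub := goldenWords_subset hA
  have h1 : ∀ m ∈ Finset.Icc 1 n, onesIncrement p A m =
      (if m ∈ A then 1 else 0) - (1 - p) * (1 - (if 2 ∣ m ∧ m / 2 ∈ A then 1 else 0)) := by
    intro m _
    unfold onesIncrement
    by_cases hb : 2 ∣ m ∧ m / 2 ∈ A
    · have hm : m ∉ A := by
        have := hA' _ hb.2
        rwa [Nat.mul_div_cancel' hb.1] at this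
      simp [hb, hm]
    · simp [hb]
  rw [onesMartingale, Finset.sum_congr rfl h1, Finset.sum_sub_distrib, ← Finset.mul_sum,
    Finset.sum_sub_distrib, Finset.sum_boole, Finset.sum_boole, card_filter_two_dvd_and_half_mem,
    Finset.filter_mem_eq_inter, Finset.inter_eq_right.2 hsub]
  simp

theorem exp_le_one_add_add_sq {x : ℝ} (hx : |x| ≤ 1) : Real.exp x ≤ 1 + x + x ^ 2 := by
  have h := abs_le.1 (Real.abs_exp_sub_one_sub_id_le hx)
  linarith [h.2]

/-- The exponential factor splits over positions and is absorbed in `α` and `β`; forced digits have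
increment 0, so `γ` stays 1. The centring cancels the linear term at each step, leaving a factor at
most `exp (l ^ 2)`. -/
theorem sum_wordWeight_mul_exp_le {p : ℝ} (hp0 : 0 < p) (hp1 : p < 1) {l : ℝ} (hl : |l| ≤ 1)
    (n : ℕ) :
    ∑ A ∈ goldenWords n, wordWeight (fun _ => 1 - p) (fun _ => p) 1 n A *
      Real.exp (l * onesMartingale p n A) ≤ Real.exp (n * l ^ 2) := by
  have h1 : ∀ A, wordWeight (fun _ => 1 - p) (fun _ => p) 1 n A *
      Real.exp (l * onesMartingale p n A) =
      wordWeight (fun _ => (1 - p) * Real.exp (l * p)) (fun _ => p * Real.exp (l * -(1 - p))) 1 n A := by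
    intro A
    rw [wordWeight, wordWeight, onesMartingale, Finset.mul_sum, Real.exp_sum,
      ← Finset.prod_mul_distrib]
    refine Finset.prod_congr rfl fun m _ => ?_
    unfold stepWeight onesIncrement
    split_ifs <;> simp
  have hq : 0 < 1 - p := by linarith
  have hl2 := abs_le.1 hl
  have hsq : (0 : ℝ) ≤ l ^ 2 := sq_nonneg l
  rw [Finset.sum_congr rfl fun A _ => h1 A, sum_goldenWords_wordWeight, Real.exp_nat_mul]
  refine sum_wordWeight_le_pow (fun _ => by positivity) (fun _ => by positivity) zero_le_one
    (fun _ => ?_) (Real.one_le_exp hsq) n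
  have e1 := exp_le_one_add_add_sq (x := l * p)
    (by rw [abs_mul, abs_of_pos hp0]; nlinarith [abs_nonneg l])
  have e2 := exp_le_one_add_add_sq (x := l * -(1 - p))
    (by rw [abs_mul, abs_neg, abs_of_pos hq]; nlinarith [abs_nonneg l])
  calc (1 - p) * Real.exp (l * p) + p * Real.exp (l * -(1 - p))
      ≤ (1 - p) * (1 + l * p + (l * p) ^ 2) +
        p * (1 + l * -(1 - p) + (l * -(1 - p)) ^ 2) := by gcongr
    _ = 1 + l ^ 2 * (p * (1 - p)) := by ring
    _ ≤ l ^ 2 + 1 := by nlinarith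
    _ ≤ Real.exp (l ^ 2) := Real.add_one_le_exp _

/-- Words with an atypical number of ones have exponentially small total weight. -/
theorem sum_wordWeight_atypical_le {p : ℝ} (hp0 : 0 < p) (hp1 : p < 1) {η : ℝ} (h0 : 0 < η)
    (h1 : η ≤ 1) (n : ℕ) :
    ∑ A ∈ (goldenWords n).filter (fun A => η * n < |onesMartingale p n A|),
      wordWeight (fun _ => 1 - p) (fun _ => p) 1 n A ≤ 2 * Real.exp (-(η ^ 2 / 4)) ^ n := by
  -- This minimises `l ^ 2 - l * η`, with minimum `-(η ^ 2 / 4)`.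
  set l := η / 2 with hl
  have hw := fun A => wordWeight_nonneg (α := fun _ => 1 - p) (β := fun _ => p) (γ := 1)
    (fun _ => by linarith) (fun _ => hp0.le) zero_le_one n A
  have ha := sum_wordWeight_mul_exp_le hp0 hp1 (l := l) (by rw [abs_of_pos] <;> linarith) n
  have hb := sum_wordWeight_mul_exp_le hp0 hp1 (l := -l) (by rw [abs_neg, abs_of_pos] <;> linarith) n
  have hmark : ∑ A ∈ (goldenWords n).filter (fun A => η * n < |onesMartingale p n A|),
      wordWeight (fun _ => 1 - p) (fun _ => p) 1 n A * Real.exp (l * (η * n)) ≤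
      ∑ A ∈ goldenWords n, (wordWeight (fun _ => 1 - p) (fun _ => p) 1 n A *
        Real.exp (l * onesMartingale p n A) + wordWeight (fun _ => 1 - p) (fun _ => p) 1 n A *
        Real.exp (-l * onesMartingale p n A)) := by
    refine (Finset.sum_le_sum fun A hA => ?_).trans
      (Finset.sum_le_sum_of_subset_of_nonneg (Finset.filter_subset _ _) fun A _ _ => ?_)
    · have h2 := (Finset.mem_filter.1 hA).2
      rw [← mul_add]
      refine mul_le_mul_of_nonneg_left ?_ (hw A)
      rcases le_total 0 (onesMartingale p n A) with h3 | h3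
      · rw [abs_of_nonneg h3] at h2
        have : Real.exp (l * (η * n)) ≤ Real.exp (l * onesMartingale p n A) := by gcongr
        linarith [Real.exp_pos (-l * onesMartingale p n A)]
      · rw [abs_of_nonpos h3] at h2
        have : Real.exp (l * (η * n)) ≤ Real.exp (-l * onesMartingale p n A) := by
          rw [neg_mul, ← mul_neg]; gcongr
        linarith [Real.exp_pos (l * onesMartingale p n A)]
    · have := hw A
      positivity
  rw [← Finset.sum_mul, Finset.sum_add_distrib] at hmark
  have e : 2 * Real.exp (-(η ^ 2 / 4)) ^ n * Real.exp (l * (η * n)) = 2 * Real.exp (n * l ^ 2) := by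
    rw [← Real.exp_nat_mul, mul_assoc, ← Real.exp_add, hl]; congr 2; ring
  refine le_of_mul_le_mul_right ?_ (Real.exp_pos (l * (η * n)))
  rw [e]
  rw [neg_sq] at hb
  linarith

/-! ### The golden Markov measure -/

/-- The digit sequence driven by independent bits: a bit is erased if the digit at half its
position is `1`. -/
def goldenDigits (ω : ℕ → Bool) (m : ℕ) : ℕ :=
  if _h : 0 < m ∧ 2 ∣ m then
    if goldenDigits ω (m / 2) = 1 then 0 else (ω m).toNat
  else (ω m).toNat
termination_by m
decreasing_by omega

theorem goldenDigits_zero_or_one (ω : ℕ → Bool) (m : ℕ) :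
    goldenDigits ω m = 0 ∨ goldenDigits ω m = 1 := by
  rw [goldenDigits]
  split_ifs <;> cases ω m <;> simp

theorem goldenDigits_mul (ω : ℕ → Bool) (m : ℕ) (hm : 1 ≤ m) :
    goldenDigits ω m * goldenDigits ω (2 * m) = 0 := by
  rcases goldenDigits_zero_or_one ω m with h | h
  · simp [h]
  · rw [goldenDigits.eq_def ω (2 * m), dif_pos (by omega), Nat.mul_div_cancel_left _ (by omega), if_pos h,
      mul_zero]

theorem measurable_goldenDigits (m : ℕ) : Measurable fun ω => goldenDigits ω m := by
  induction m using Nat.strong_induction_on with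
  | _ m ih =>
    have hb : Measurable fun ω : ℕ → Bool => (ω m).toNat :=
      (measurable_of_countable Bool.toNat).comp (measurable_pi_apply m)
    by_cases h : 0 < m ∧ 2 ∣ m
    · have e : (fun ω => goldenDigits ω m) =
          fun ω => if goldenDigits ω (m / 2) = 1 then 0 else (ω m).toNat := by
        funext ω; rw [goldenDigits, dif_pos h]
      rw [e]
      exact Measurable.ite (ih (m / 2) (by omega) (measurableSet_singleton 1)) measurable_const hb
    · have e : (fun ω => goldenDigits ω m) = fun ω : ℕ → Bool => (ω m).toNat := by
        funext ω; rw [goldenDigits, dif_neg h]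
      rw [e]
      exact hb

theorem onesUpTo_goldenDigits_mem (ω : ℕ → Bool) (n : ℕ) :
    onesUpTo (goldenDigits ω) n ∈ goldenWords n :=
  onesUpTo_mem (goldenDigits_mul ω) n

/-- The point of the multiplicative golden mean set with digits `goldenDigits ω`. -/
noncomputable def goldenPoint (ω : ℕ → Bool) : ℝ :=
  ∑' n : ℕ, (goldenDigits ω (n + 1) : ℝ) / 2 ^ (n + 1)

theorem hasSum_goldenPoint (ω : ℕ → Bool) :
    HasSum (fun n : ℕ => (goldenDigits ω (n + 1) : ℝ) / 2 ^ (n + 1)) (goldenPoint ω) := by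
  refine Summable.hasSum (Summable.of_nonneg_of_le (fun n => by positivity) (fun n => ?_)
    (summable_geometric_of_lt_one (r := (1 / 2 : ℝ)) (by norm_num) (by norm_num)))
  have : (goldenDigits ω (n + 1) : ℝ) ≤ 1 := by
    rcases goldenDigits_zero_or_one ω (n + 1) with h | h <;> simp [h]
  rw [one_div_pow]
  exact div_le_div₀ zero_le_one this (by positivity) (pow_le_pow_right₀ (by norm_num) (by omega))

theorem goldenPoint_mem (ω : ℕ → Bool) : goldenPoint ω ∈ multGoldenMeanSet :=
  ⟨_, fun k _ => goldenDigits_zero_or_one ω k, goldenDigits_mul ω, hasSum_goldenPoint ω⟩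

theorem binaryValue_goldenDigits (ω : ℕ → Bool) (n : ℕ) :
    binaryValue (onesUpTo (goldenDigits ω) n) ≤ goldenPoint ω ∧
      goldenPoint ω ≤ binaryValue (onesUpTo (goldenDigits ω) n) + 1 / 2 ^ n :=
  binaryValue_onesUpTo_mem (fun k _ => goldenDigits_zero_or_one ω k) (hasSum_goldenPoint ω) n

theorem measurable_goldenPoint : Measurable goldenPoint := by
  refine measurable_of_tendsto_metrizable
    (f := fun n ω => ∑ i ∈ Finset.range n, (goldenDigits ω (i + 1) : ℝ) / 2 ^ (i + 1)) (fun n => ?_)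
    (tendsto_pi_nhds.2 fun ω => (hasSum_goldenPoint ω).tendsto_sum_nat)
  refine Finset.measurable_sum _ fun i _ => Measurable.div_const ?_ _
  exact (measurable_of_countable (Nat.cast : ℕ → ℝ)).comp (measurable_goldenDigits (i + 1))

/-- There is a probability measure giving each cylinder at most its golden Markov weight. -/
theorem exists_goldenMeasure {p : ℝ} (hp0 : 0 < p) (hp1 : p < 1) :
    ∃ μ : MeasureTheory.Measure (ℕ → Bool), MeasureTheory.IsProbabilityMeasure μ ∧
      ∀ n, ∀ A ∈ goldenWords n, μ {ω | onesUpTo (goldenDigits ω) n = A} ≤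
        ENNReal.ofReal (wordWeight (fun _ => 1 - p) (fun _ => p) 1 n A) := by
  set ν : MeasureTheory.Measure Bool := ENNReal.ofReal (1 - p) • MeasureTheory.Measure.dirac true +
    ENNReal.ofReal p • MeasureTheory.Measure.dirac false with hν
  have hνp : MeasureTheory.IsProbabilityMeasure ν := by
    refine ⟨?_⟩
    simp only [hν, MeasureTheory.Measure.add_apply, MeasureTheory.Measure.smul_apply,
      MeasureTheory.measure_univ, smul_eq_mul, mul_one]
    rw [← ENNReal.ofReal_add (by linarith) hp0.le]
    simp
  refine ⟨MeasureTheory.Measure.infinitePi fun _ : ℕ => ν, inferInstance, fun n A hA => ?_⟩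
  have hA' := (Finset.mem_filter.1 hA).2
  -- The bits compatible with the word: at a forced 0 the bit is erased, hence unrestricted.
  let T : ℕ → Set Bool := fun m =>
    if 2 ∣ m ∧ m / 2 ∈ A then Set.univ else (if m ∈ A then {true} else {false})
  have hsub : {ω | onesUpTo (goldenDigits ω) n = A} ⊆ Set.pi (Finset.Icc 1 n : Finset ℕ) T := by
    intro ω hω m hm
    have hω' : onesUpTo (goldenDigits ω) n = A := hω
    have hm := Finset.mem_coe.1 hm
    have hmem : ∀ k ∈ Finset.Icc 1 n, (k ∈ A ↔ goldenDigits ω k = 1) := by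
      intro k hk
      rw [← hω', onesUpTo, Finset.mem_filter]
      exact and_iff_right hk
    simp only [T]
    by_cases hb : 2 ∣ m ∧ m / 2 ∈ A
    · simp [hb]
    · have hdig : goldenDigits ω m = (ω m).toNat := by
        rw [goldenDigits]
        split_ifs with h1 h2
        · exfalso
          have h3 := Finset.mem_Icc.1 hm
          exact hb ⟨h1.2, (hmem _ (Finset.mem_Icc.2 (by omega))).2 h2⟩
        all_goals rfl
      have h4 := hmem m hm
      rw [hdig] at h4
      rw [if_neg hb]
      split_ifs with h5
      · have := h4.1 h5
        cases h6 : ω m <;> simp_all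
      · cases h6 : ω m <;> simp_all
  refine (MeasureTheory.measure_mono hsub).trans ?_
  rw [MeasureTheory.Measure.infinitePi_pi _ fun _ _ => MeasurableSet.of_discrete, wordWeight,
    ENNReal.ofReal_prod_of_nonneg fun m _ =>
      stepWeight_nonneg (fun _ => by linarith) (fun _ => hp0.le) zero_le_one A m]
  refine Finset.prod_le_prod' fun m _ => ?_
  simp only [T, stepWeight]
  by_cases hb : 2 ∣ m ∧ m / 2 ∈ A
  · have hm : m ∉ A := by
      have := hA' _ hb.2
      rwa [Nat.mul_div_cancel' hb.1] at this
    simp only [hb, hm, and_self, if_true, if_false, ENNReal.ofReal_one]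
    exact MeasureTheory.prob_le_one
  · by_cases hm : m ∈ A
    · simp [hb, hm, hν]
    · simp [hb, hm, hν]

/-- Borel–Cantelli: the atypical words have geometrically small measure at each length. -/
theorem ae_eventually_abs_onesMartingale_le {p : ℝ} (hp0 : 0 < p) (hp1 : p < 1)
    {μ : MeasureTheory.Measure (ℕ → Bool)}
    (hμ : ∀ n, ∀ A ∈ goldenWords n, μ {ω | onesUpTo (goldenDigits ω) n = A} ≤
        ENNReal.ofReal (wordWeight (fun _ => 1 - p) (fun _ => p) 1 n A))
    {η : ℝ} (h0 : 0 < η) (h1 : η ≤ 1) :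
    ∀ᵐ ω ∂μ, ∀ᶠ n : ℕ in atTop, |onesMartingale p n (onesUpTo (goldenDigits ω) n)| ≤ η * n := by
  have hbound : ∀ n : ℕ, μ {ω | η * n < |onesMartingale p n (onesUpTo (goldenDigits ω) n)|} ≤
      ENNReal.ofReal (2 * Real.exp (-(η ^ 2 / 4)) ^ n) := by
    intro n
    have hsub : {ω | η * n < |onesMartingale p n (onesUpTo (goldenDigits ω) n)|} ⊆
        ⋃ A ∈ (goldenWords n).filter (fun A => η * n < |onesMartingale p n A|),
          {ω | onesUpTo (goldenDigits ω) n = A} := by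
      intro ω hω
      exact Set.mem_iUnion₂.2
        ⟨_, Finset.mem_filter.2 ⟨onesUpTo_goldenDigits_mem ω n, hω⟩, rfl⟩
    refine (MeasureTheory.measure_mono hsub).trans
      ((MeasureTheory.measure_biUnion_finset_le _ _).trans ?_)
    refine (Finset.sum_le_sum fun A hA => hμ n A (Finset.mem_filter.1 hA).1).trans ?_
    rw [← ENNReal.ofReal_sum_of_nonneg fun A _ =>
      wordWeight_nonneg (fun _ => by linarith) (fun _ => hp0.le) zero_le_one n A]
    exact ENNReal.ofReal_le_ofReal (sum_wordWeight_atypical_le hp0 hp1 h0 h1 n)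
  have hsum : ∑' n : ℕ, μ {ω | η * n < |onesMartingale p n (onesUpTo (goldenDigits ω) n)|} ≠ ∞ := by
    refine ne_top_of_le_ne_top ?_ (ENNReal.tsum_le_tsum hbound)
    refine Summable.tsum_ofReal_ne_top (Summable.mul_left 2 (summable_geometric_of_lt_one
      (Real.exp_pos _).le ?_))
    rw [Real.exp_lt_one_iff]
    have : 0 < η ^ 2 := by positivity
    linarith
  have h := MeasureTheory.ae_eventually_notMem hsum
  filter_upwards [h] with ω hω
  filter_upwards [hω] with n hn
  simpa using hn

/-- If the compensated number of ones is small, then the density of ones converges, so that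
the exponent of the golden Markov weight is asymptotically at least `n`. -/
theorem exists_forall_exponent_ge {p : ℝ} (hp0 : 0 < p) (hp1 : p < 1) {η : ℝ} (h0 : 0 < η)
    {u : ℕ → ℝ} (hu0 : ∀ n, 0 ≤ u n) (hun : ∀ n, u n ≤ n) {n₀ : ℕ}
    (hu : ∀ n ≥ n₀, |u n - (1 - p) * (n - u (n / 2))| ≤ η * n) :
    ∃ n₁, ∀ n ≥ n₁, -(3 * η * n) ≤ u n / 2 - u (n / 2) := by
  set q := 1 - p with hq
  have hq0 : 0 < q := by linarith
  have hq1 : q < 1 := by linarith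
  -- The limiting density of ones, the fixed point of `b = q * (1 - b / 2)`.
  set b := q / (1 + q / 2) with hb
  have hbq : b * (1 + q / 2) = q := div_mul_cancel₀ _ (by positivity)
  have hb0 : 0 < b := by positivity
  have hb1 : b ≤ 1 := by nlinarith
  have hfloor : ∀ n : ℕ, ((n / 2 : ℕ) : ℝ) ≤ n / 2 ∧ (n : ℝ) / 2 ≤ (n / 2 : ℕ) + 1 / 2 := by
    intro n
    have h1 : ((n / 2 : ℕ) : ℝ) * 2 ≤ n := by exact_mod_cast Nat.div_mul_le_self n 2
    have h2 : (n : ℝ) ≤ (n / 2 : ℕ) * 2 + 1 := by exact_mod_cast (by omega : n ≤ n / 2 * 2 + 1)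
    constructor <;> linarith
  -- `C` covers all `n < n₀`, and `q * C + 1 / 2 ≤ C` lets it absorb the rounding of `n / 2`.
  obtain ⟨C, hC1, hC2⟩ : ∃ C : ℝ, (n₀ : ℝ) ≤ C ∧ 1 / 2 ≤ p * C := by
    refine ⟨n₀ + 1 / p, by simp [hp0.le], ?_⟩
    rw [mul_add, mul_one_div_cancel hp0.ne']
    have : 0 ≤ p * n₀ := by positivity
    linarith
  have hC0 : 0 ≤ C := le_trans (Nat.cast_nonneg _) hC1
  have key : ∀ n : ℕ, |u n - b * n| ≤ 2 * η * n + C := by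
    intro n
    induction n using Nat.strong_induction_on with
    | _ n ih =>
      have hn0 : (0 : ℝ) ≤ n := Nat.cast_nonneg n
      rcases Nat.lt_or_ge n n₀ with hn | hn
      · have h1 : (n : ℝ) ≤ n₀ := by exact_mod_cast hn.le
        have h2 := hu0 n
        have h3 := hun n
        have h4 : 0 ≤ b * n := by positivity
        have h5 : b * n ≤ n := by nlinarith
        have h6 : 0 ≤ η * n := by positivity
        rw [abs_le]; constructor <;> linarith
      · rcases Nat.eq_zero_or_pos n with rfl | hpos
        · have h2 := hu0 0
          have h3 := hun 0
          rw [Nat.cast_zero] at h3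
          have : u 0 = 0 := le_antisymm h3 h2
          simpa [this] using hC0
        · have h1 := abs_le.1 (ih (n / 2) (by omega))
          have h2 := abs_le.1 (hu n hn)
          have h3 := hfloor n
          generalize ((n / 2 : ℕ) : ℝ) = m at *
          generalize u (n / 2) = v at *
          -- The deviation at `n` is the given error, minus `q` times the deviation at `n / 2`, plus
          -- a rounding term. As `q < 1`, the bound reproduces itself.
          have e : u n - b * n = (u n - q * (n - v)) - q * (v - b * m) + q * b * (n / 2 - m) := by
            have : b * n = q * n - b * (q / 2) * n := by
              calc b * n = (b * (1 + q / 2)) * n - b * (q / 2) * n := by ring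
                _ = _ := by rw [hbq]
            rw [this]; ring
          have h4 : 0 ≤ q * b * (n / 2 - m) := mul_nonneg (by positivity) (by linarith)
          have h5 : q * b * (n / 2 - m) ≤ 1 / 2 := by
            have : q * b ≤ 1 := by nlinarith
            nlinarith
          have h6 : q * |v - b * m| ≤ η * n + q * C := by
            have h7 : |v - b * m| ≤ η * n + C := by
              rw [abs_le]; constructor <;> nlinarith
            have h8 : 0 ≤ η * n := by positivity
            nlinarith
          have h7 : |q * (v - b * m)| ≤ η * n + q * C := by
            rwa [abs_mul, abs_of_pos hq0]
          have h8 := abs_le.1 h7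
          have h9 : q * C + 1 / 2 ≤ C := by rw [hq]; linarith
          rw [e, abs_le]
          constructor <;> linarith [h2.1, h2.2, h8.1, h8.2]
  obtain ⟨n₁, hn₁⟩ := exists_nat_ge (3 * C / 2 / η)
  refine ⟨n₁, fun n hn => ?_⟩
  have h1 : 3 * C / 2 ≤ η * n := by
    rw [div_le_iff₀ h0] at hn₁
    have : (n₁ : ℝ) ≤ n := by exact_mod_cast hn
    nlinarith
  have h2 := abs_le.1 (key n)
  have h3 := abs_le.1 (key (n / 2))
  have h4 := hfloor n
  generalize ((n / 2 : ℕ) : ℝ) = m at *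
  generalize u (n / 2) = v at *
  have h5 : 2 * η * m ≤ η * n := by nlinarith
  have h6 : b * m ≤ b * (n / 2) := by gcongr; exact h4.1
  linarith [h2.1, h3.2]

theorem ae_eventually_wordWeight_le {p : ℝ} (hp0 : 0 < p) (hp1 : p < 1)
    (hp : p ^ 3 = (1 - p) ^ 2) {μ : MeasureTheory.Measure (ℕ → Bool)}
    (hμ : ∀ n, ∀ A ∈ goldenWords n, μ {ω | onesUpTo (goldenDigits ω) n = A} ≤
        ENNReal.ofReal (wordWeight (fun _ => 1 - p) (fun _ => p) 1 n A))
    {η : ℝ} (h0 : 0 < η) (h1 : η ≤ 1) :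
    ∀ᵐ ω ∂μ, ∃ n₁ : ℕ, ∀ n ≥ n₁, wordWeight (fun _ => 1 - p) (fun _ => p) 1 n
      (onesUpTo (goldenDigits ω) n) ≤ p ^ ((n : ℝ) * (1 - 3 * η)) := by
  filter_upwards [ae_eventually_abs_onesMartingale_le hp0 hp1 hμ h0 h1] with ω hω
  obtain ⟨n₀, hn₀⟩ := eventually_atTop.1 hω
  obtain ⟨n₁, hn₁⟩ := exists_forall_exponent_ge hp0 hp1 h0
    (u := fun n => ((onesUpTo (goldenDigits ω) n).card : ℝ)) (fun n => by positivity)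
    (fun n => by exact_mod_cast card_onesUpTo_le _ n) (n₀ := n₀) (fun n hn => by
      have h := hn₀ n hn
      rwa [onesMartingale_eq p (onesUpTo_goldenDigits_mem ω n),
        onesUpTo_inter _ (Nat.div_le_self n 2)] at h)
  refine ⟨n₁, fun n hn => ?_⟩
  rw [wordWeight_golden hp0 hp1 hp (onesUpTo_goldenDigits_mem ω n),
    onesUpTo_inter _ (Nat.div_le_self n 2)]
  refine Real.rpow_le_rpow_of_exponent_ge hp0 hp1.le ?_
  have := hn₁ n hn
  linarith

/-! ### Mass distribution and the lower bound for the Hausdorff dimension -/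

/-- The measure of the parameters of a short interval. -/
theorem measure_goldenPoint_mem_le {p : ℝ} {μ : MeasureTheory.Measure (ℕ → Bool)}
    (hμ : ∀ n, ∀ A ∈ goldenWords n, μ {ω | onesUpTo (goldenDigits ω) n = A} ≤
        ENNReal.ofReal (wordWeight (fun _ => 1 - p) (fun _ => p) 1 n A)) (n : ℕ) (a c : ℝ) :
    μ {ω | goldenPoint ω ∈ Set.Icc (a - 1 / 2 ^ n) (a + 1 / 2 ^ n) ∧
      wordWeight (fun _ => 1 - p) (fun _ => p) 1 n (onesUpTo (goldenDigits ω) n) ≤ c} ≤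
      4 * ENNReal.ofReal c := by
  -- A prefix value lies at most `1 / 2 ^ n` below its point, hence in an interval of length `3 / 2
  -- ^ n`, which holds at most 4 word values.
  set W := ((goldenWords n).filter fun A => binaryValue A ∈
    Set.Icc (a - 2 / 2 ^ n) (a - 2 / 2 ^ n + (3 : ℕ) / 2 ^ n)).filter fun A =>
      wordWeight (fun _ => 1 - p) (fun _ => p) 1 n A ≤ c with hW
  have hsub : {ω | goldenPoint ω ∈ Set.Icc (a - 1 / 2 ^ n) (a + 1 / 2 ^ n) ∧
      wordWeight (fun _ => 1 - p) (fun _ => p) 1 n (onesUpTo (goldenDigits ω) n) ≤ c} ⊆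
      ⋃ A ∈ W, {ω | onesUpTo (goldenDigits ω) n = A} := by
    rintro ω ⟨h1, h2⟩
    refine Set.mem_iUnion₂.2 ⟨_, Finset.mem_filter.2
      ⟨Finset.mem_filter.2 ⟨onesUpTo_goldenDigits_mem ω n, ?_⟩, h2⟩, rfl⟩
    have h3 := binaryValue_goldenDigits ω n
    rw [Set.mem_Icc] at h1 ⊢
    have e2 : (2 : ℝ) / 2 ^ n = 2 * (1 / 2 ^ n) := by ring
    have e3 : ((3 : ℕ) : ℝ) / 2 ^ n = 3 * (1 / 2 ^ n) := by push_cast; ring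
    rw [e2, e3]
    constructor <;> linarith [h1.1, h1.2, h3.1, h3.2]
  refine (MeasureTheory.measure_mono hsub).trans
    ((MeasureTheory.measure_biUnion_finset_le _ _).trans ?_)
  have hc : W.card ≤ 4 := (Finset.card_filter_le _ _).trans (card_goldenWords_filter_le n _ 3)
  calc _ ≤ ∑ _A ∈ W, ENNReal.ofReal c := Finset.sum_le_sum fun A hA =>
        (hμ n A (Finset.mem_filter.1 (Finset.mem_filter.1 hA).1).1).trans
          (ENNReal.ofReal_le_ofReal (Finset.mem_filter.1 hA).2)
    _ = W.card * ENNReal.ofReal c := by rw [Finset.sum_const, nsmul_eq_mul]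
    _ ≤ _ := by gcongr; exact_mod_cast hc

/-- A mass distribution principle on the real line, tested on dyadic scales. -/
theorem le_dimH_of_dyadic {ρ : MeasureTheory.Measure ℝ} {s : Set ℝ} (hs : ρ s ≠ 0) {t : ℝ≥0}
    (ht : 0 < t) {n₁ : ℕ} (h : ∀ n ≥ n₁, ∀ a : ℝ, ρ (Set.Icc (a - 1 / 2 ^ n) (a + 1 / 2 ^ n)) ≤
      4 * ENNReal.ofReal (((1 / 2) ^ n) ^ (t : ℝ))) : (t : ℝ≥0∞) ≤ dimH s := by
  refine le_dimH_of_hausdorffMeasure_ne_zero ?_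
  have ht' : (0 : ℝ) < t := ht
  -- A set of diameter `D > 0` is tested at the dyadic scale in `[D, 2 * D)`, which costs the factor
  -- `2 ^ t`.
  set c : ℝ≥0∞ := 4 * ENNReal.ofReal (2 ^ (t : ℝ)) with hc
  have hc0 : c ≠ 0 := by
    rw [hc, Ne, mul_eq_zero, not_or, ENNReal.ofReal_eq_zero, not_le]
    exact ⟨by norm_num, by positivity⟩
  have hctop : c ≠ ⊤ := ENNReal.mul_ne_top (by norm_num) ENNReal.ofReal_ne_top
  have hmass : c⁻¹ • ρ ≤ MeasureTheory.Measure.hausdorffMeasure (t : ℝ) := by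
    refine MeasureTheory.Measure.le_hausdorffMeasure (t : ℝ) _ (ENNReal.ofReal ((1 / 2) ^ n₁))
      (by rw [ENNReal.ofReal_pos]; positivity) fun U hU => ?_
    rw [MeasureTheory.Measure.smul_apply, smul_eq_mul]
    rw [← ENNReal.div_eq_inv_mul]
    refine ENNReal.div_le_of_le_mul' ?_
    rcases U.eq_empty_or_nonempty with rfl | ⟨a, ha⟩
    · simp
    have hfin : Metric.ediam U ≠ ⊤ := ne_top_of_le_ne_top ENNReal.ofReal_ne_top hU
    set D := (Metric.ediam U).toReal with hD
    have hD' : Metric.ediam U = ENNReal.ofReal D := (ENNReal.ofReal_toReal hfin).symm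
    have hD0 : 0 ≤ D := ENNReal.toReal_nonneg
    have hDn : D ≤ (1 / 2) ^ n₁ := ENNReal.toReal_le_of_le_ofReal (by positivity) hU
    have hball : ∀ n ≥ n₁, D ≤ (1 / 2) ^ n → ρ U ≤ 4 * ENNReal.ofReal (((1 / 2) ^ n) ^ (t : ℝ)) := by
      intro n hn hDn
      refine (MeasureTheory.measure_mono fun y hy => ?_).trans (h n hn a)
      have h1 : dist y a ≤ D := by
        rw [dist_edist]
        exact ENNReal.toReal_mono hfin (Metric.edist_le_ediam_of_mem hy ha)
      rw [Real.dist_eq, abs_le] at h1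
      rw [one_div_pow] at hDn
      constructor <;> linarith [h1.1, h1.2]
    rw [hD', ENNReal.ofReal_rpow_of_nonneg hD0 t.coe_nonneg]
    -- A set of diameter 0 fits every scale, so letting `n` tend to infinity shows that it is null.
    rcases hD0.eq_or_lt with h0 | h0
    · rw [← h0, Real.zero_rpow ht'.ne', ENNReal.ofReal_zero, mul_zero]
      have hlim : Tendsto (fun n : ℕ => 4 * ENNReal.ofReal (((1 / 2 : ℝ) ^ n) ^ (t : ℝ))) atTop
          (𝓝 0) := by
        have h1 : Tendsto (fun n : ℕ => ((1 / 2 : ℝ) ^ n) ^ (t : ℝ)) atTop (𝓝 0) := by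
          have := (tendsto_pow_atTop_nhds_zero_of_lt_one (r := (1 / 2 : ℝ)) (by norm_num)
            (by norm_num)).rpow_const (p := (t : ℝ)) (Or.inr ht'.le)
          rwa [Real.zero_rpow ht'.ne'] at this
        have h2 := ENNReal.Tendsto.const_mul (a := 4) (ENNReal.tendsto_ofReal h1)
          (Or.inr (by norm_num))
        rwa [ENNReal.ofReal_zero, mul_zero] at h2
      refine ge_of_tendsto hlim ?_
      filter_upwards [eventually_ge_atTop n₁] with n hn
      exact hball n hn (h0 ▸ by positivity)
    · obtain ⟨n, hn1, hn2⟩ := exists_nat_pow_near_of_lt_one h0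
        (hDn.trans (pow_le_one₀ (by norm_num) (by norm_num))) (by norm_num : (0 : ℝ) < 1 / 2)
        (by norm_num)
      have hn : n₁ ≤ n := by
        by_contra hlt
        have : (1 / 2 : ℝ) ^ n₁ ≤ (1 / 2) ^ (n + 1) :=
          pow_le_pow_of_le_one (by norm_num) (by norm_num) (by omega)
        linarith
      refine (hball n hn hn2).trans ?_
      rw [hc, mul_assoc, ← ENNReal.ofReal_mul (by positivity),
        ← Real.mul_rpow (by norm_num) hD0]
      gcongr
      rw [pow_succ] at hn1
      linarith
  intro h0
  have h1 := hmass s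
  rw [h0, MeasureTheory.Measure.smul_apply, smul_eq_mul, nonpos_iff_eq_zero, mul_eq_zero,
    ENNReal.inv_eq_zero] at h1
  exact h1.elim hctop hs

theorem le_dimH_multGoldenMeanSet {p : ℝ} (hp0 : 0 < p) (hp1 : p < 1) (hp : p ^ 3 = (1 - p) ^ 2) :
    ENNReal.ofReal (-Real.logb 2 p) ≤ dimH multGoldenMeanSet := by
  set s := -Real.logb 2 p with hs
  have hs0 : 0 < s := by
    have := Real.logb_neg (b := 2) (by norm_num) hp0 hp1
    linarith
  have main : ∀ t : ℝ≥0, 0 < t → (t : ℝ) < s → (t : ℝ≥0∞) ≤ dimH multGoldenMeanSet := by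
    intro t ht hts
    have ht' : (0 : ℝ) < t := ht
    set η := (s - t) / (3 * s) with hη
    have hη0 : 0 < η := div_pos (by linarith) (by linarith)
    have hη1 : η ≤ 1 := by rw [hη, div_le_one (by linarith)]; linarith
    have hst : s * (1 - 3 * η) = t := by rw [hη]; field_simp; ring
    obtain ⟨μ, hprob, hμ⟩ := exists_goldenMeasure hp0 hp1
    have hae := ae_eventually_wordWeight_le hp0 hp1 hp hμ hη0 hη1
    let G : ℕ → Set (ℕ → Bool) := fun n₁ => {ω | ∀ n ≥ n₁,
      wordWeight (fun _ => 1 - p) (fun _ => p) 1 n (onesUpTo (goldenDigits ω) n) ≤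
        ((1 / 2) ^ n) ^ (t : ℝ)}
    have hpow : ∀ n : ℕ, p ^ ((n : ℝ) * (1 - 3 * η)) = ((1 / 2) ^ n) ^ (t : ℝ) := by
      intro n
      rw [two_rpow_neg_logb hp0, ← hs, ← hst, one_div, inv_pow, ← Real.rpow_natCast,
        ← Real.rpow_neg (by norm_num), ← Real.rpow_mul (by norm_num)]
      congr 1; ring
    -- Almost every `ω` lies in some `G n₁`, so one of these countably many sets is not null;
    -- restricting `μ` to it makes the weight bound uniform.
    obtain ⟨n₁, hn₁⟩ : ∃ n₁, μ (G n₁) ≠ 0 := by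
      by_contra! hG
      have h1 : μ (⋃ n, G n) = 0 := MeasureTheory.measure_iUnion_null hG
      have h2 : ∀ᵐ ω ∂μ, ω ∈ ⋃ n, G n := by
        filter_upwards [hae] with ω hω
        obtain ⟨n₁, h⟩ := hω
        exact Set.mem_iUnion.2 ⟨n₁, fun n hn => (h n hn).trans (hpow n).le⟩
      have h3 : ∀ᵐ ω ∂μ, ω ∉ ⋃ n, G n := MeasureTheory.measure_eq_zero_iff_ae_notMem.1 h1
      obtain ⟨ω, h4, h5⟩ := (h2.and h3).exists
      exact h5 h4
    refine le_dimH_of_dyadic (ρ := (μ.restrict (G n₁)).map goldenPoint) ?_ ht (n₁ := n₁) ?_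
    · have h1 : goldenPoint ⁻¹' multGoldenMeanSet = Set.univ :=
        Set.eq_univ_of_forall goldenPoint_mem
      -- Only this inequality is needed, so measurability of the target set plays no role.
      have h2 := MeasureTheory.Measure.le_map_apply (μ := μ.restrict (G n₁))
        measurable_goldenPoint.aemeasurable multGoldenMeanSet
      rw [h1, MeasureTheory.Measure.restrict_apply_univ] at h2
      exact ((pos_iff_ne_zero.2 hn₁).trans_le h2).ne'
    · intro n hn a
      rw [MeasureTheory.Measure.map_apply measurable_goldenPoint measurableSet_Icc,
        MeasureTheory.Measure.restrict_apply (measurable_goldenPoint measurableSet_Icc)]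
      refine (MeasureTheory.measure_mono ?_).trans (measure_goldenPoint_mem_le hμ n a _)
      rintro ω ⟨h1, h2⟩
      exact ⟨h1, h2 n hn⟩
  refine le_of_forall_lt fun c hc => ?_
  obtain ⟨t, h1, h2⟩ := ENNReal.lt_iff_exists_nnreal_btwn.1 hc
  refine h1.trans_le (main t ?_ ?_)
  · have : (0 : ℝ≥0∞) < t := lt_of_le_of_lt zero_le h1
    exact_mod_cast this
  · rw [← ENNReal.ofReal_coe_nnreal] at h2
    exact (ENNReal.ofReal_lt_ofReal_iff hs0).1 h2

theorem dimH_multGoldenMeanSet {p : ℝ} (hp0 : 0 < p) (hp1 : p < 1) (hp : p ^ 3 = (1 - p) ^ 2) :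
    dimH multGoldenMeanSet = ENNReal.ofReal (-Real.logb 2 p) :=
  le_antisymm (dimH_multGoldenMeanSet_le hp0 hp1 hp) (le_dimH_multGoldenMeanSet hp0 hp1 hp)

/-! ### Numerical bounds -/

theorem div_le_logb_of_pow_le {x : ℝ} {a b : ℕ} (hb : 0 < b) (h : 2 ^ a ≤ x ^ b) :
    (a / b : ℝ) ≤ Real.logb 2 x := by
  have h1 := Real.logb_le_logb_of_le (b := 2) (by norm_num) (by positivity) h
  rw [Real.logb_pow, Real.logb_pow, Real.logb_self_eq_one (by norm_num), mul_one] at h1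
  rw [div_le_iff₀ (by exact_mod_cast hb)]
  linarith

theorem logb_le_div_of_le_pow {x : ℝ} (hx : 0 < x) {a b : ℕ} (hb : 0 < b) (h : x ^ b ≤ 2 ^ a) :
    Real.logb 2 x ≤ (a / b : ℝ) := by
  have h1 := Real.logb_le_logb_of_le (b := 2) (by norm_num) (by positivity) h
  rw [Real.logb_pow, Real.logb_pow, Real.logb_self_eq_one (by norm_num), mul_one] at h1
  rw [le_div_iff₀ (by exact_mod_cast hb)]
  linarith

theorem div_le_chainEntropy {k a b : ℕ} (hb : 0 < b) (h : 2 ^ a ≤ Nat.fib (k + 2) ^ b) :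
    (a / b : ℝ) ≤ chainEntropy k :=
  div_le_logb_of_pow_le hb (by exact_mod_cast h)

theorem chainEntropy_le_div {k a b : ℕ} (hb : 0 < b) (h : Nat.fib (k + 2) ^ b ≤ 2 ^ a) :
    chainEntropy k ≤ (a / b : ℝ) :=
  logb_le_div_of_le_pow (by linarith [one_le_fib_add_two k]) hb (by exact_mod_cast h)

-- Rational lower bounds for the first 22 entropies, each certified by comparing integer powers; the
-- remaining terms are nonnegative.
set_option exponentiation.threshold 4000 in
theorem le_tsum_chainEntropy :
    (0.82429 : ℝ) ≤ ∑' k : ℕ, chainEntropy (k + 1) * (1 / 2 ^ (k + 2)) := by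
  refine le_trans ?_ (summable_chainEntropy.sum_le_tsum (Finset.range 22) fun k _ =>
    mul_nonneg (chainEntropy_nonneg _) (by positivity))
  have h0 : (1 / 1 : ℝ) ≤ chainEntropy 1 := by
    exact_mod_cast div_le_chainEntropy (a := 1) (b := 1) (by norm_num) (by norm_num)
  have h1 : (1054 / 665 : ℝ) ≤ chainEntropy 2 := by
    exact_mod_cast div_le_chainEntropy (a := 1054) (b := 665) (by norm_num) (by norm_num)
  have h2 : (1832 / 789 : ℝ) ≤ chainEntropy 3 := by
    exact_mod_cast div_le_chainEntropy (a := 1832) (b := 789) (by norm_num) (by norm_num)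
  have h3 : (3 / 1 : ℝ) ≤ chainEntropy 4 := by
    exact_mod_cast div_le_chainEntropy (a := 3) (b := 1) (by norm_num) (by norm_num)
  have h4 : (1717 / 464 : ℝ) ≤ chainEntropy 5 := by
    exact_mod_cast div_le_chainEntropy (a := 1717) (b := 464) (by norm_num) (by norm_num)
  have h5 : (571 / 130 : ℝ) ≤ chainEntropy 6 := by
    exact_mod_cast div_le_chainEntropy (a := 571) (b := 130) (by norm_num) (by norm_num)
  have h6 : (1338 / 263 : ℝ) ≤ chainEntropy 7 := by
    exact_mod_cast div_le_chainEntropy (a := 1338) (b := 263) (by norm_num) (by norm_num)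
  have h7 : (1798 / 311 : ℝ) ≤ chainEntropy 8 := by
    exact_mod_cast div_le_chainEntropy (a := 1798) (b := 311) (by norm_num) (by norm_num)
  have h8 : (667 / 103 : ℝ) ≤ chainEntropy 9 := by
    exact_mod_cast div_le_chainEntropy (a := 667) (b := 103) (by norm_num) (by norm_num)
  have h9 : (1477 / 206 : ℝ) ≤ chainEntropy 10 := by
    exact_mod_cast div_le_chainEntropy (a := 1477) (b := 206) (by norm_num) (by norm_num)
  have h10 : (1447 / 184 : ℝ) ≤ chainEntropy 11 := by
    exact_mod_cast div_le_chainEntropy (a := 1447) (b := 184) (by norm_num) (by norm_num)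
  have h11 : (1027 / 120 : ℝ) ≤ chainEntropy 12 := by
    exact_mod_cast div_le_chainEntropy (a := 1027) (b := 120) (by norm_num) (by norm_num)
  have h12 : (879 / 95 : ℝ) ≤ chainEntropy 13 := by
    exact_mod_cast div_le_chainEntropy (a := 879) (b := 95) (by norm_num) (by norm_num)
  have h13 : (746 / 75 : ℝ) ≤ chainEntropy 14 := by
    exact_mod_cast div_le_chainEntropy (a := 746) (b := 75) (by norm_num) (by norm_num)
  have h14 : (415 / 39 : ℝ) ≤ chainEntropy 15 := by
    exact_mod_cast div_le_chainEntropy (a := 415) (b := 39) (by norm_num) (by norm_num)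
  have h15 : (1859 / 164 : ℝ) ≤ chainEntropy 16 := by
    exact_mod_cast div_le_chainEntropy (a := 1859) (b := 164) (by norm_num) (by norm_num)
  have h16 : (409 / 34 : ℝ) ≤ chainEntropy 17 := by
    exact_mod_cast div_le_chainEntropy (a := 409) (b := 34) (by norm_num) (by norm_num)
  have h17 : (598 / 47 : ℝ) ≤ chainEntropy 18 := by
    exact_mod_cast div_le_chainEntropy (a := 598) (b := 47) (by norm_num) (by norm_num)
  have h18 : (899 / 67 : ℝ) ≤ chainEntropy 19 := by
    exact_mod_cast div_le_chainEntropy (a := 899) (b := 67) (by norm_num) (by norm_num)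
  have h19 : (127 / 9 : ℝ) ≤ chainEntropy 20 := by
    exact_mod_cast div_le_chainEntropy (a := 127) (b := 9) (by norm_num) (by norm_num)
  have h20 : (459 / 31 : ℝ) ≤ chainEntropy 21 := by
    exact_mod_cast div_le_chainEntropy (a := 459) (b := 31) (by norm_num) (by norm_num)
  have h21 : (31 / 2 : ℝ) ≤ chainEntropy 22 := by
    exact_mod_cast div_le_chainEntropy (a := 31) (b := 2) (by norm_num) (by norm_num)
  simp only [Finset.sum_range_succ, Finset.sum_range_zero, zero_add, Nat.reduceAdd]
  norm_num only at *
  linarith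

/-- Majorises the tail after 22 terms through `chainEntropy k ≤ k`; the numerator is `∑ k / 2 ^ k +
23 * ∑ 1 / 2 ^ k = 2 + 46`. -/
theorem hasSum_chainEntropy_tail_bound :
    HasSum (fun k : ℕ => ((k : ℝ) + 23) * (1 / 2 ^ (k + 24))) (48 / 2 ^ 24) := by
  have h1 := hasSum_coe_mul_geometric_of_norm_lt_one (r := (1 / 2 : ℝ)) (by norm_num)
  have h2 := (hasSum_geometric_of_lt_one (r := (1 / 2 : ℝ)) (by norm_num) (by norm_num)).mul_left 23
  have h3 := (h1.add h2).mul_left (1 / 2 ^ 24)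
  have e : (fun k : ℕ => ((k : ℝ) + 23) * (1 / 2 ^ (k + 24))) =
      fun k : ℕ => (1 / 2 ^ 24 : ℝ) * (k * (1 / 2) ^ k + 23 * (1 / 2) ^ k) := by
    funext k
    rw [one_div_pow, pow_add]
    field_simp
  have e2 : (48 / 2 ^ 24 : ℝ) = 1 / 2 ^ 24 * (1 / 2 / (1 - 1 / 2) ^ 2 + 23 * (1 - 1 / 2)⁻¹) := by
    norm_num
  rw [e, e2]
  exact h3

set_option exponentiation.threshold 4000 in
theorem tsum_chainEntropy_lt :
    ∑' k : ℕ, chainEntropy (k + 1) * (1 / 2 ^ (k + 2)) < (0.82430 : ℝ) := by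
  have htail : ∑' k : ℕ, chainEntropy (k + 22 + 1) * (1 / 2 ^ (k + 22 + 2)) ≤ (48 / 2 ^ 24 : ℝ) := by
    rw [← hasSum_chainEntropy_tail_bound.tsum_eq]
    refine Summable.tsum_le_tsum (fun k => ?_) ((summable_nat_add_iff 22).2 summable_chainEntropy)
      hasSum_chainEntropy_tail_bound.summable
    have h := chainEntropy_le (k + 22 + 1)
    push_cast at h
    gcongr
    linarith
  rw [← summable_chainEntropy.sum_add_tsum_nat_add 22]
  have h0 : chainEntropy 1 ≤ (1 / 1 : ℝ) := by
    exact_mod_cast chainEntropy_le_div (a := 1) (b := 1) (by norm_num) (by norm_num)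
  have h1 : chainEntropy 2 ≤ (1539 / 971 : ℝ) := by
    exact_mod_cast chainEntropy_le_div (a := 1539) (b := 971) (by norm_num) (by norm_num)
  have h2 : chainEntropy 3 ≤ (1154 / 497 : ℝ) := by
    exact_mod_cast chainEntropy_le_div (a := 1154) (b := 497) (by norm_num) (by norm_num)
  have h3 : chainEntropy 4 ≤ (3 / 1 : ℝ) := by
    exact_mod_cast chainEntropy_le_div (a := 3) (b := 1) (by norm_num) (by norm_num)
  have h4 : chainEntropy 5 ≤ (840 / 227 : ℝ) := by
    exact_mod_cast chainEntropy_le_div (a := 840) (b := 227) (by norm_num) (by norm_num)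
  have h5 : chainEntropy 6 ≤ (1489 / 339 : ℝ) := by
    exact_mod_cast chainEntropy_le_div (a := 1489) (b := 339) (by norm_num) (by norm_num)
  have h6 : chainEntropy 7 ≤ (1745 / 343 : ℝ) := by
    exact_mod_cast chainEntropy_le_div (a := 1745) (b := 343) (by norm_num) (by norm_num)
  have h7 : chainEntropy 8 ≤ (1243 / 215 : ℝ) := by
    exact_mod_cast chainEntropy_le_div (a := 1243) (b := 215) (by norm_num) (by norm_num)
  have h8 : chainEntropy 9 ≤ (1470 / 227 : ℝ) := by
    exact_mod_cast chainEntropy_le_div (a := 1470) (b := 227) (by norm_num) (by norm_num)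
  have h9 : chainEntropy 10 ≤ (717 / 100 : ℝ) := by
    exact_mod_cast chainEntropy_le_div (a := 717) (b := 100) (by norm_num) (by norm_num)
  have h10 : chainEntropy 11 ≤ (637 / 81 : ℝ) := by
    exact_mod_cast chainEntropy_le_div (a := 637) (b := 81) (by norm_num) (by norm_num)
  have h11 : chainEntropy 12 ≤ (659 / 77 : ℝ) := by
    exact_mod_cast chainEntropy_le_div (a := 659) (b := 77) (by norm_num) (by norm_num)
  have h12 : chainEntropy 13 ≤ (842 / 91 : ℝ) := by
    exact_mod_cast chainEntropy_le_div (a := 842) (b := 91) (by norm_num) (by norm_num)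
  have h13 : chainEntropy 14 ≤ (1313 / 132 : ℝ) := by
    exact_mod_cast chainEntropy_le_div (a := 1313) (b := 132) (by norm_num) (by norm_num)
  have h14 : chainEntropy 15 ≤ (979 / 92 : ℝ) := by
    exact_mod_cast chainEntropy_le_div (a := 979) (b := 92) (by norm_num) (by norm_num)
  have h15 : chainEntropy 16 ≤ (1417 / 125 : ℝ) := by
    exact_mod_cast chainEntropy_le_div (a := 1417) (b := 125) (by norm_num) (by norm_num)
  have h16 : chainEntropy 17 ≤ (806 / 67 : ℝ) := by
    exact_mod_cast chainEntropy_le_div (a := 806) (b := 67) (by norm_num) (by norm_num)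
  have h17 : chainEntropy 18 ≤ (369 / 29 : ℝ) := by
    exact_mod_cast chainEntropy_le_div (a := 369) (b := 29) (by norm_num) (by norm_num)
  have h18 : chainEntropy 19 ≤ (416 / 31 : ℝ) := by
    exact_mod_cast chainEntropy_le_div (a := 416) (b := 31) (by norm_num) (by norm_num)
  have h19 : chainEntropy 20 ≤ (494 / 35 : ℝ) := by
    exact_mod_cast chainEntropy_le_div (a := 494) (b := 35) (by norm_num) (by norm_num)
  have h20 : chainEntropy 21 ≤ (385 / 26 : ℝ) := by
    exact_mod_cast chainEntropy_le_div (a := 385) (b := 26) (by norm_num) (by norm_num)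
  have h21 : chainEntropy 22 ≤ (1318 / 85 : ℝ) := by
    exact_mod_cast chainEntropy_le_div (a := 1318) (b := 85) (by norm_num) (by norm_num)
  simp only [Finset.sum_range_succ, Finset.sum_range_zero, zero_add, Nat.reduceAdd]
  norm_num only at *
  linarith

theorem existsUnique_golden : ∃! p : ℝ, 0 < p ∧ p < 1 ∧ p ^ 3 = (1 - p) ^ 2 := by
  have hcont : ContinuousOn (fun p : ℝ => p ^ 3 - (1 - p) ^ 2) (Set.Icc 0 1) := by fun_prop
  obtain ⟨p, hp, h⟩ := intermediate_value_Ioo zero_le_one hcont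
    (show (0 : ℝ) ∈ Set.Ioo _ _ by constructor <;> norm_num)
  refine ⟨p, ⟨hp.1, hp.2, by simpa [sub_eq_zero] using h⟩, ?_⟩
  rintro q ⟨hq0, hq1, hq⟩
  have h' : p ^ 3 = (1 - p) ^ 2 := by simpa [sub_eq_zero] using h
  -- The second factor is positive since `p` and `q` lie in `(0, 1)`.
  have h3 : (q - p) * (q ^ 2 + q * p + p ^ 2 + (2 - p - q)) = 0 := by linear_combination hq - h'
  rcases mul_eq_zero.1 h3 with h4 | h4
  · linarith
  · nlinarith [hp.1, hp.2, mul_pos hq0 hp.1]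

/-- On `(0, 1)` the cube increases while `(1 - p) ^ 2` decreases, so the sign of their difference at
`r` locates the root. -/
theorem golden_le {p r : ℝ} (hp1 : p < 1) (hp : p ^ 3 = (1 - p) ^ 2) (hr0 : 0 < r)
    (hr : (1 - r) ^ 2 ≤ r ^ 3) : p ≤ r := by
  by_contra! h
  have h1 : r ^ 3 < p ^ 3 := by gcongr
  nlinarith

theorem le_golden {p r : ℝ} (hp0 : 0 < p) (hp : p ^ 3 = (1 - p) ^ 2) (hr1 : r < 1)
    (hr : r ^ 3 ≤ (1 - r) ^ 2) : r ≤ p := by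
  by_contra! h
  have h1 : p ^ 3 < r ^ 3 := by gcongr
  nlinarith

set_option exponentiation.threshold 4000 in
theorem neg_logb_golden_bounds {p : ℝ} (hp0 : 0 < p) (hp1 : p < 1) (hp : p ^ 3 = (1 - p) ^ 2) :
    0.81137 ≤ -Real.logb 2 p ∧ -Real.logb 2 p < 0.81138 := by
  have h1 : p ≤ 5698403 / 10000000 := golden_le hp1 hp (by norm_num) (by norm_num)
  have h2 : 56984 / 100000 ≤ p := le_golden hp0 hp (by norm_num) (by norm_num)
  rw [← Real.logb_inv]
  constructor
  -- The fractions `2469 / 3043` here and `271 / 334` below lie between 0.81137 and 0.81138.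
  · have hn : 2 ^ 2469 * 5698403 ^ 3043 ≤ 10000000 ^ 3043 := by norm_num
    have h3 : (2 : ℝ) ^ 2469 ≤ (p⁻¹) ^ 3043 := by
      have h4 : (10000000 / 5698403 : ℝ) ≤ p⁻¹ := by
        rw [le_inv_comm₀ (by norm_num) hp0, inv_div]; exact h1
      refine le_trans ?_ (pow_le_pow_left₀ (by norm_num) h4 3043)
      rw [div_pow, le_div_iff₀ (by positivity)]
      exact_mod_cast hn
    have h5 := div_le_logb_of_pow_le (by norm_num) h3
    push_cast at h5
    exact le_trans (by norm_num) h5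
  · have hn : 100000 ^ 334 ≤ 2 ^ 271 * 56984 ^ 334 := by norm_num
    have h3 : (p⁻¹) ^ 334 ≤ (2 : ℝ) ^ 271 := by
      have h4 : p⁻¹ ≤ (100000 / 56984 : ℝ) := by
        rw [inv_le_comm₀ hp0 (by norm_num), inv_div]; exact h2
      refine le_trans (pow_le_pow_left₀ (inv_pos.2 hp0).le h4 334) ?_
      rw [div_pow, div_le_iff₀ (by positivity)]
      exact_mod_cast hn
    have h5 := logb_le_div_of_le_pow (inv_pos.2 hp0) (by norm_num) h3
    push_cast at h5
    exact lt_of_le_of_lt h5 (by norm_num)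

theorem proposition1p1 :
    (∃! p : ℝ, 0 < p ∧ p < 1 ∧ p ^ 3 = (1 - p) ^ 2) ∧
    (∀ p : ℝ, 0 < p → p < 1 → p ^ 3 = (1 - p) ^ 2 →
      dimH multGoldenMeanSet = ENNReal.ofReal (-Real.logb 2 p) ∧
      0.81137 ≤ -Real.logb 2 p ∧ -Real.logb 2 p < 0.81138) ∧
    (∃ d : ℝ,
      HasSum (fun n : ℕ =>
        Real.logb 2 (shiftedFib ((n + 1) + 1) : ℝ) / 2 ^ ((n + 1) + 1)) d ∧
      0.82429 ≤ d ∧ d < 0.82430 ∧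
      HasMinkowskiDim multGoldenMeanSet d ∧
      dimH multGoldenMeanSet < ENNReal.ofReal d) := by
  refine ⟨existsUnique_golden, fun p hp0 hp1 hp =>
    ⟨dimH_multGoldenMeanSet hp0 hp1 hp, neg_logb_golden_bounds hp0 hp1 hp⟩, _, ?_,
    le_tsum_chainEntropy, tsum_chainEntropy_lt, hasMinkowskiDim_multGoldenMeanSet, ?_⟩
  · have h := summable_chainEntropy.hasSum
    simp only [mul_one_div] at h ⊢
    -- Both sides unfold to `Nat.fib (n + 3)` inside the logarithm.
    exact h
  · obtain ⟨p, ⟨hp0, hp1, hp⟩, -⟩ := existsUnique_golden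
    have h1 := (neg_logb_golden_bounds hp0 hp1 hp).2
    have h2 := le_tsum_chainEntropy
    rw [dimH_multGoldenMeanSet hp0 hp1 hp, ENNReal.ofReal_lt_ofReal_iff (by linarith)]
    linarith
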